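/- Let $V$ be a vertex operator algebra over $\mathbb{C}$ with vacuum vector $\mathbf 1$, Virasoro vector $\omega$ and $n$-th products $a_{(n)}b$ ($n\in\mathbb Z$). Let $V_d$ denote the eigenspace of $L_0=\omega_{(1)}$ for the eigenvalue $d\in\mathbb Z$; thus $V=\bigoplus_{d}V_d$, where every $V_d$ is finite dimensional and $V_d=0$ for all sufficiently small $d$. Assume that $V$ is simple and of CFT type, that is, $V_d=0$ for $d<0$ and $V_0=\mathbb C\mathbf 1$. Let $T=(V\otimes V)^{S_2}$ be the subspace of $V\otimes V$ fixed by the flip $a\otimes b\mapsto b\otimes a$, with the products induced by $(a\otimes b)_{(n)}(c\otimes d)=\sum_{i\in\mathbb Z}a_{(i)}c\otimes b_{(n-1-i)}d$. Put $C_2(T)=\langle u_{(-2)}v\mid u,v\in T\rangle_{\mathbb C}$ and $R(T)=T/C_2(T)$. Let $\overline{\eta}\colon V\to R(T)$ be the linear map $\overline\eta(a)=a\otimes\mathbf 1+\mathbf 1\otimes a+C_2(T)$, and for $x,y\in V$ put $$D(x,y)=\langle\,\overline\eta(x_{(-n)}y)\mid n\in\mathbb Z_{>0}\,\rangle_{\mathbb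 C}\subseteq R(T).$$ Then for any $x,y\in V_1$ the space $D(x,y)$ is finite dimensional. Moreover, if $\langle x,x\rangle\neq 0$, where $\langle\cdot,\cdot\rangle$ is the bilinear form on $V_1$ given by $u_{(1)}v=\langle u,v\rangle\mathbf 1$, then $\overline\eta(x_{(-m)}y)=0$ for all integers $m\ge 14$. -/

import Mathlib

open scoped TensorProduct

/-- A vertex algebra structure on a complex vector space `V`, given by its `n`-th products
`prod n a b = a_(n) b` (`n ∈ ℤ`) and its vacuum vector. -/
structure VertexAlgebra (V : Type*) [AddCommGroup V] [Module ℂ V] where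
  /-- The `n`-th product `a_(n) b`, bilinear in `a` and `b`. -/
  prod : ℤ → V →ₗ[ℂ] V →ₗ[ℂ] V
  /-- The vacuum vector. -/
  vac : V
  /-- Truncation: `a_(n) b = 0` for all sufficiently large `n`. -/
  truncation : ∀ a b : V, ∃ N : ℤ, ∀ n : ℤ, N ≤ n → prod n a b = 0
  vac_prod : ∀ (n : ℤ) (a : V), prod n vac a = if n = -1 then a else 0
  prod_vac_of_nonneg : ∀ (n : ℤ) (a : V), 0 ≤ n → prod n a vac = 0
  prod_vac_neg_one : ∀ a : V, prod (-1) a vac = a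
  /-- The Borcherds identity. By truncation both sums have only finitely many nonzero terms. -/
  borcherds : ∀ (a b c : V) (p q r : ℤ),
    (∑ᶠ i : ℕ, Ring.choose p i • prod (p + q - i) (prod (r + i) a b) c) =
      ∑ᶠ i : ℕ, ((-1 : ℤ) ^ i * Ring.choose r i) •
        (prod (p + r - i) a (prod (q + i) b c) -
          (r.negOnePow : ℤ) • prod (q + r - i) b (prod (p + i) a c))

/-- A vertex operator algebra: a vertex algebra with a Virasoro vector `ω`, whose modes
`L_n = ω_(n+1)` satisfy the Virasoro relations, such that `L_{-1} a = a_(-2) 𝟏`, and such that `V`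
is the direct sum of the eigenspaces of `L_0` for integral eigenvalues, which are finite
dimensional and vanish for all sufficiently small eigenvalues. -/
structure VertexOperatorAlgebra (V : Type*) [AddCommGroup V] [Module ℂ V] extends
    VertexAlgebra V where
  /-- The Virasoro vector. -/
  omega : V
  /-- The central charge. -/
  centralCharge : ℂ
  virasoro : ∀ (m n : ℤ) (a : V),
    prod (m + 1) omega (prod (n + 1) omega a) - prod (n + 1) omega (prod (m + 1) omega a) =
      ((m : ℂ) - n) • prod (m + n + 1) omega a +
        if m + n = 0 then (((m : ℂ) ^ 3 - m) / 12 * centralCharge) • a else 0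
  translation : ∀ a : V, prod 0 omega a = prod (-2) a vac
  isInternal : DirectSum.IsInternal
    (fun d : ℤ => Module.End.eigenspace (prod 1 omega : Module.End ℂ V) (d : ℂ))
  finiteDimensional_eigenspace : ∀ d : ℤ, FiniteDimensional ℂ
    (Module.End.eigenspace (prod 1 omega : Module.End ℂ V) (d : ℂ))
  bounded_below : ∃ t : ℤ, ∀ d : ℤ, d < t →
    Module.End.eigenspace (prod 1 omega : Module.End ℂ V) (d : ℂ) = ⊥

namespace VertexAlgebra

variable {V : Type*} [AddCommGroup V] [Module ℂ V] (A : VertexAlgebra V)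

/-- An ideal of a vertex algebra: a subspace stable under all products, from either side, with
arbitrary elements. -/
def IsIdeal (I : Submodule ℂ V) : Prop :=
  ∀ (a : V), ∀ w ∈ I, ∀ n : ℤ, A.prod n a w ∈ I ∧ A.prod n w a ∈ I

/-- A vertex algebra is simple if it is nonzero and has no ideals except `0` and itself. -/
def IsSimple : Prop :=
  Nontrivial V ∧ ∀ I : Submodule ℂ V, A.IsIdeal I → I = ⊥ ∨ I = ⊤

/-- The contribution `(a ⊗ b), (c ⊗ d) ↦ a_(i) c ⊗ b_(n-1-i) d` to the `n`-th product of
`V ⊗ V`. -/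
noncomputable def tensorTerm (n i : ℤ) : (V ⊗[ℂ] V) →ₗ[ℂ] (V ⊗[ℂ] V) →ₗ[ℂ] (V ⊗[ℂ] V) :=
  TensorProduct.map₂ (A.prod i) (A.prod (n - 1 - i))

/-- The `n`-th product of the tensor product vertex algebra `V ⊗ V`:
`(a ⊗ b)_(n) (c ⊗ d) = ∑_{i ∈ ℤ} a_(i) c ⊗ b_(n-1-i) d`, a finite sum. -/
noncomputable def tensorProd (n : ℤ) (u v : V ⊗[ℂ] V) : V ⊗[ℂ] V :=
  ∑ᶠ i : ℤ, A.tensorTerm n i u v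

theorem finite_support_tensorTerm (n : ℤ) (u v : V ⊗[ℂ] V) :
    (Function.support fun i : ℤ => A.tensorTerm n i u v).Finite := by
  induction u using TensorProduct.induction_on with
  | zero => simp
  | add u₁ u₂ h₁ h₂ =>
    refine (h₁.union h₂).subset fun i hi => ?_
    by_contra hc
    simp only [Set.mem_union, Function.mem_support, not_or, not_not] at hc
    simp [hc.1, hc.2] at hi
  | tmul a b =>
    induction v using TensorProduct.induction_on with
    | zero => simp
    | add v₁ v₂ h₁ h₂ =>
      refine (h₁.union h₂).subset fun i hi => ?_
      by_contra hc
      simp only [Set.mem_union, Function.mem_support, not_or, not_not] at hc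
      simp [hc.1, hc.2] at hi
    | tmul c d =>
      obtain ⟨N, hN⟩ := A.truncation a c
      obtain ⟨M, hM⟩ := A.truncation b d
      refine (Set.finite_Icc (n - 1 - M) N).subset fun i hi => ?_
      by_contra hc
      apply hi
      simp only [tensorTerm, TensorProduct.map₂_apply_tmul, TensorProduct.map_tmul]
      rw [Set.mem_Icc, not_and_or, not_le, not_le] at hc
      rcases hc with h | h
      · rw [hM (n - 1 - i) (by lia), TensorProduct.tmul_zero]
      · rw [hN i h.le, TensorProduct.zero_tmul]

/-- The fixed points `(V ⊗ V)^{S₂}` of the flip `a ⊗ b ↦ b ⊗ a`. -/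
noncomputable def orbifold (_A : VertexAlgebra V) : Submodule ℂ (V ⊗[ℂ] V) :=
  LinearMap.eqLocus (TensorProduct.comm ℂ V V).toLinearMap LinearMap.id

theorem comm_tensorTerm (n i : ℤ) (u v : V ⊗[ℂ] V) :
    TensorProduct.comm ℂ V V (A.tensorTerm n i u v) =
      A.tensorTerm n (n - 1 - i) (TensorProduct.comm ℂ V V u) (TensorProduct.comm ℂ V V v) := by
  induction u using TensorProduct.induction_on with
  | zero => simp
  | add u₁ u₂ h₁ h₂ => simp [h₁, h₂]
  | tmul a b =>
    induction v using TensorProduct.induction_on with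
    | zero => simp
    | add v₁ v₂ h₁ h₂ => simp only [map_add, h₁, h₂]
    | tmul c d => simp [tensorTerm]

theorem tensorProd_mem_orbifold (n : ℤ) {u v : V ⊗[ℂ] V} (hu : u ∈ A.orbifold)
    (hv : v ∈ A.orbifold) : A.tensorProd n u v ∈ A.orbifold := by
  have hu' : TensorProduct.comm ℂ V V u = u := hu
  have hv' : TensorProduct.comm ℂ V V v = v := hv
  change TensorProduct.comm ℂ V V (∑ᶠ i : ℤ, A.tensorTerm n i u v) =
    ∑ᶠ i : ℤ, A.tensorTerm n i u v
  have h := (TensorProduct.comm ℂ V V).toLinearMap.toAddMonoidHom.map_finsum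
    (A.finite_support_tensorTerm n u v)
  refine h.trans ?_
  rw [← finsum_comp_equiv (Equiv.subLeft (n - 1))]
  refine finsum_congr fun i => ?_
  refine (A.comm_tensorTerm n _ u v).trans ?_
  rw [hu', hv']
  simp

/-- The `n`-th product of the permutation orbifold model `(V ⊗ V)^{S₂}`. -/
noncomputable def orbifoldProd (n : ℤ) (u v : A.orbifold) : A.orbifold :=
  ⟨A.tensorProd n u v, A.tensorProd_mem_orbifold n u.2 v.2⟩

/-- The subspace `C₂(T) = ⟨u_(-2) v ∣ u, v ∈ T⟩` of `T = (V ⊗ V)^{S₂}`. -/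
noncomputable def orbifoldC2 : Submodule ℂ A.orbifold :=
  Submodule.span ℂ {w | ∃ u v : A.orbifold, w = A.orbifoldProd (-2) u v}

/-- The quotient `R(T) = T / C₂(T)` for `T = (V ⊗ V)^{S₂}`. -/
abbrev OrbifoldR : Type _ := A.orbifold ⧸ A.orbifoldC2

/-- The linear map `η : V → (V ⊗ V)^{S₂}`, `η(a) = a ⊗ 𝟏 + 𝟏 ⊗ a`. -/
noncomputable def eta : V →ₗ[ℂ] A.orbifold :=
  LinearMap.codRestrict A.orbifold
    ((TensorProduct.mk ℂ V V).flip A.vac + TensorProduct.mk ℂ V V A.vac)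
    (fun a => by
      change TensorProduct.comm ℂ V V (a ⊗ₜ[ℂ] A.vac + A.vac ⊗ₜ[ℂ] a) =
        a ⊗ₜ[ℂ] A.vac + A.vac ⊗ₜ[ℂ] a
      simp [add_comm])

/-- The composite `η̄` of `η` with the projection onto `R((V ⊗ V)^{S₂})`. -/
noncomputable def etaBar : V →ₗ[ℂ] A.OrbifoldR :=
  A.orbifoldC2.mkQ ∘ₗ A.eta

/-- The subspace `D(x, y) = ⟨η̄(x_(-n) y) ∣ n ∈ ℤ, n > 0⟩` of `R((V ⊗ V)^{S₂})`. -/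
noncomputable def D (x y : V) : Submodule ℂ A.OrbifoldR :=
  Submodule.span ℂ {w | ∃ n : ℤ, 0 < n ∧ w = A.etaBar (A.prod (-n) x y)}

end VertexAlgebra

namespace VertexOperatorAlgebra

variable {V : Type*} [AddCommGroup V] [Module ℂ V] (A : VertexOperatorAlgebra V)

/-- The homogeneous subspace `V_d`, the eigenspace of `L_0 = ω_(1)` for the eigenvalue `d`. -/
noncomputable def weightSpace (d : ℤ) : Submodule ℂ V :=
  Module.End.eigenspace (A.prod 1 A.omega : Module.End ℂ V) (d : ℂ)

/-- `V` is of CFT type: `V_d = 0` for `d < 0` and `V_0 = ℂ 𝟏`. -/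
def IsCFTType : Prop :=
  (∀ d : ℤ, d < 0 → A.weightSpace d = ⊥) ∧ A.weightSpace 0 = Submodule.span ℂ {A.vac}

end VertexOperatorAlgebra

/-! A functional f on R(T), composed with symmetrization, becomes a functional on V ⊗ V that kills
u_(n) v for u, v ∈ T and n ≤ -2. Call a ⊗ 𝟏 - 𝟏 ⊗ a the odd vector of a. A product of two odd
vectors is flip-invariant, and because (a ⊗ 𝟏 + 𝟏 ⊗ a)_(n) (b ⊗ 𝟏 + 𝟏 ⊗ b) lies in C₂(T) for n ≤ -2,
the odd product represents 2 η̄(a_(n) b) there.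

Consider the correlation function of four odd vectors, the last one at the origin. By locality and
truncation (`cleared_mono_eq_zero`) it equals F/Δ, with Δ = ∏ (z_i - z_j)^{N_ij} ∏ z_i^{M_i} and F a
power series. Fusing the fields i and j gives an invariant vector; its products of index ≤ -2 with
the invariant product of the other two die under f. Hence, in the coordinates z_i - z_j, z_j, z_k,
the degree of F in z_j is at most the degree c_ij of Δ in z_j, that is, (∂_i + ∂_j)^{c_ij + 1} F = 0
(`cleared_pairD`). The three operators ∂_i + ∂_j span all ∂_l, so F is a polynomial of degree at
most ∑ c_ij = 2 deg Δ, and F/Δ has no terms of degree above deg Δ (`φ_mono_eq_zero`).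

If a²_(k) d = l 𝟏 with l ≠ 0, the coefficient indexed by (-m, -1, k) is 8 l f(η̄(a⁰_(-m) a¹)), which
therefore vanishes for m > k + 2 + deg Δ. Simplicity provides such an a² for d = x ≠ 0, whence
finite dimensionality. For the explicit bound, y is split into a multiple of x and a part orthogonal
to x. The orthogonal part has deg Δ = 9. For y = x, skew-symmetry handles even m; for odd m one has
deg Δ = 12, and the boundary value m = 15 needs the top-degree part of F to vanish
(`φ_mono_eq_zero_of_top`). -/

/-- Laurent polynomials in three variables. -/
abbrev Laurent : Type := AddMonoidAlgebra ℂ (Fin 3 → ℤ)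

/-! ### Functionals on Laurent polynomials, seen as formal series ∑ φ(z^n) z^{-n-1} -/

namespace Laurent

open Filter

/-- The monomial `z ^ n`. -/
noncomputable def mono (n : Fin 3 → ℤ) : Laurent := AddMonoidAlgebra.single n 1

/-- The exponent of the variable `z i`. -/
def e (i : Fin 3) : Fin 3 → ℤ := Pi.single i 1

/-- The variable `z i`. -/
noncomputable def z (i : Fin 3) : Laurent := mono (e i)

theorem mono_mul (m n : Fin 3 → ℤ) : mono m * mono n = mono (m + n) := by
  simp [mono, AddMonoidAlgebra.single_mul_single]

@[simp] theorem e_same (i : Fin 3) : e i i = 1 := by simp [e]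

theorem e_ne {i j : Fin 3} (h : j ≠ i) : e i j = 0 := by simp [e, h]

theorem z_mul_mono (i : Fin 3) (n : Fin 3 → ℤ) : z i * mono n = mono (n + e i) := by
  rw [z, mono_mul, add_comm]

theorem span_mono : Submodule.span ℂ (Set.range mono) = ⊤ := by
  refine eq_top_iff.2 fun f _ => ?_
  induction f using AddMonoidAlgebra.induction_linear with
  | zero => exact Submodule.zero_mem _
  | add f g hf hg => exact Submodule.add_mem _ (hf trivial) (hg trivial)
  | single n c =>
    have : AddMonoidAlgebra.single n c = c • mono n := by simp [mono]
    rw [this]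
    exact Submodule.smul_mem _ _ (Submodule.subset_span ⟨n, rfl⟩)

theorem induction {p : Laurent → Prop} (f : Laurent) (hm : ∀ n, p (mono n)) (h0 : p 0)
    (ha : ∀ f g, p f → p g → p (f + g)) (hs : ∀ (c : ℂ) f, p f → p (c • f)) : p f := by
  have hf : f ∈ Submodule.span ℂ (Set.range mono) := span_mono ▸ Submodule.mem_top
  induction hf using Submodule.span_induction with
  | mem x hx => obtain ⟨n, rfl⟩ := hx; exact hm n
  | zero => exact h0
  | add x y _ _ hx hy => exact ha _ _ hx hy
  | smul c x _ hx => exact hs _ _ hx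

/-- The linear map with prescribed values on monomials. -/
noncomputable def liftMono {W : Type*} [AddCommGroup W] [Module ℂ W] (φ : (Fin 3 → ℤ) → W) :
    Laurent →ₗ[ℂ] W where
  toFun f := f.coeff.sum fun n c => c • φ n
  map_add' f g := by
    rw [AddMonoidAlgebra.coeff_add]
    exact Finsupp.sum_add_index' (by simp) (by intros; exact add_smul _ _ _)
  map_smul' c f := by
    rw [AddMonoidAlgebra.coeff_smul, Finsupp.sum_smul_index (by simp)]
    simp [Finsupp.smul_sum, mul_smul]

@[simp] theorem liftMono_mono {W : Type*} [AddCommGroup W] [Module ℂ W] (φ : (Fin 3 → ℤ) → W)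
    (n : Fin 3 → ℤ) : liftMono φ (mono n) = φ n := by
  simp [liftMono, mono]

/-- The functional `f ↦ φ (g * f)`. -/
noncomputable def act (g : Laurent) (φ : Laurent →ₗ[ℂ] ℂ) : Laurent →ₗ[ℂ] ℂ :=
  φ ∘ₗ LinearMap.mulLeft ℂ g

@[simp] theorem act_apply (g : Laurent) (φ : Laurent →ₗ[ℂ] ℂ) (f : Laurent) :
    act g φ f = φ (g * f) := rfl

theorem act_mul (g g' : Laurent) (φ : Laurent →ₗ[ℂ] ℂ) : act (g * g') φ = act g' (act g φ) := by
  ext f; simp [mul_assoc]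

/-- `φ` vanishes far out in the direction `v`. -/
def Trunc (v : Fin 3 → ℤ) (φ : Laurent →ₗ[ℂ] ℂ) : Prop :=
  ∀ n, ∀ᶠ m : ℕ in atTop, φ (mono (n + (m : ℤ) • v)) = 0

theorem Trunc.act {v : Fin 3 → ℤ} {φ : Laurent →ₗ[ℂ] ℂ} (h : Trunc v φ) (g : Laurent) :
    Trunc v (act g φ) := by
  intro n
  induction g using Laurent.induction with
  | hm k =>
    filter_upwards [h (k + n)] with m hm
    rw [act_apply, mono_mul, ← add_assoc, hm]
  | h0 => simp
  | ha f g hf hg =>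
    filter_upwards [hf, hg] with m hm hm'
    simp only [act_apply] at hm hm' ⊢
    rw [add_mul, map_add, hm, hm', add_zero]
  | hs c f hf =>
    filter_upwards [hf] with m hm
    simp only [act_apply] at hm ⊢
    rw [smul_mul_assoc, map_smul, hm, smul_zero]

/-! ### The substitution z_i ↦ z_i - z_j and the associativity formula -/

/-- `q` is the expansion of `(φ, φ')` after the substitution `z i = z i - z j`. -/
def ExpRel (i j : Fin 3) (φ φ' q : Laurent →ₗ[ℂ] ℂ) : Prop :=
  ∀ n, ∀ᶠ B : ℕ in atTop, q (mono n) = ∑ m ∈ Finset.range B,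
    (-1 : ℂ) ^ m * (Ring.choose (n i) m : ℤ) * (φ (mono (n + (m : ℤ) • (e j - e i))) -
      ((n i).negOnePow : ℤ) * φ' (mono (n + (n i - m) • (e j - e i))))

/-- Multiplication by `g` in the original variables corresponds to multiplication by `g'` in the
new ones. -/
def Compat (i j : Fin 3) (g g' : Laurent) : Prop :=
  ∀ φ φ' q : Laurent →ₗ[ℂ] ℂ, Trunc (e j - e i) φ → Trunc (e i - e j) φ' → ExpRel i j φ φ' q →
    ExpRel i j (act g φ) (act g φ') (act g' q)

theorem Compat.mul {i j : Fin 3} {g g' f f' : Laurent} (hg : Compat i j g g')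
    (hf : Compat i j f f') : Compat i j (g * f) (g' * f') := by
  intro φ φ' q h h' hq
  simp only [act_mul]
  exact hf _ _ _ (h.act g) (h'.act g) (hg _ _ _ h h' hq)

theorem Compat.one {i j : Fin 3} : Compat i j 1 1 := by
  intro φ φ' q h h' hq n
  simpa using hq n

theorem Compat.pow {i j : Fin 3} {g g' : Laurent} (hg : Compat i j g g') (k : ℕ) :
    Compat i j (g ^ k) (g' ^ k) := by
  induction k with
  | zero => simpa using Compat.one
  | succ k ih => simpa [pow_succ] using ih.mul hg

theorem Compat.add {i j : Fin 3} {g g' f f' : Laurent} (hg : Compat i j g g')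
    (hf : Compat i j f f') : Compat i j (g + f) (g' + f') := by
  intro φ φ' q h h' hq n
  filter_upwards [hg _ _ _ h h' hq n, hf _ _ _ h h' hq n] with B h1 h2
  simp only [act_apply] at h1 h2 ⊢
  simp only [add_mul, map_add, h1, h2, ← Finset.sum_add_distrib]
  refine Finset.sum_congr rfl fun m _ => ?_
  ring

theorem Compat.neg {i j : Fin 3} {g g' : Laurent} (hg : Compat i j g g') :
    Compat i j (-g) (-g') := by
  intro φ φ' q h h' hq n
  filter_upwards [hg _ _ _ h h' hq n] with B h1
  simp only [act_apply] at h1 ⊢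
  simp only [neg_mul, map_neg, h1, ← Finset.sum_neg_distrib]
  refine Finset.sum_congr rfl fun m _ => ?_
  ring

theorem Compat.sub {i j : Fin 3} {g g' f f' : Laurent} (hg : Compat i j g g')
    (hf : Compat i j f f') : Compat i j (g - f) (g' - f') := by
  simpa [sub_eq_add_neg] using hg.add hf.neg

theorem Compat.z_of_ne {i j k : Fin 3} (hk : k ≠ i) : Compat i j (z k) (z k) := by
  intro φ φ' q _ _ hq n
  filter_upwards [hq (n + e k)] with B h
  have hi : (n + e k) i = n i := by simp [e_ne hk.symm]
  rw [hi] at h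
  rw [act_apply, z_mul_mono, h]
  refine Finset.sum_congr rfl fun m _ => ?_
  simp only [act_apply, z_mul_mono, add_right_comm]

/-- Summation by parts from Pascal's rule; the last summand is the boundary term of the truncation.
-/
theorem sum_range_choose_succ (r : ℤ) (X : ℕ → ℂ) (B : ℕ) :
    ∑ m ∈ Finset.range (B + 1), (-1 : ℂ) ^ m * (Ring.choose (r + 1) m : ℤ) * X m =
      ∑ m ∈ Finset.range B, (-1 : ℂ) ^ m * (Ring.choose r m : ℤ) * (X m - X (m + 1)) +
        (-1 : ℂ) ^ B * (Ring.choose r B : ℤ) * X B := by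
  rw [Finset.sum_range_succ']
  have h : ∀ m : ℕ, (-1 : ℂ) ^ (m + 1) * (Ring.choose (r + 1) (m + 1) : ℤ) * X (m + 1) =
      (-1 : ℂ) ^ m * (Ring.choose r m : ℤ) * (- X (m + 1)) +
        (-1 : ℂ) ^ (m + 1) * (Ring.choose r (m + 1) : ℤ) * X (m + 1) := by
    intro m
    rw [Ring.choose_succ_succ]
    push_cast
    ring
  simp only [h, Finset.sum_add_distrib, mul_sub, Finset.sum_sub_distrib]
  have h2 := Finset.sum_range_succ' (fun m => (-1 : ℂ) ^ m * (Ring.choose r m : ℤ) * X m) B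
  rw [Finset.sum_range_succ] at h2
  simp only [Ring.choose_zero_right] at h2 ⊢
  rw [Finset.sum_congr rfl fun m _ => mul_neg _ _, Finset.sum_neg_distrib]
  linear_combination -h2

/-- Raising the exponent of z_i - z_j by one is Pascal's rule for the binomial expansion. Both
halves of the boundary term vanish for large B, by the truncation of φ and of φ' respectively. -/
theorem Compat.z_sub_z {i j : Fin 3} : Compat i j (z i - z j) (z i) := by
  intro φ φ' q hφ hφ' hq n
  have t1 := hφ (n + e i)
  have t2 := (tendsto_add_atTop_nat 1).eventually (hφ' (n + e i + (n i + 2) • (e j - e i)))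
  filter_upwards [(tendsto_add_atTop_nat 1).eventually (hq (n + e i)), t1, t2] with B h t1 t2
  have hi : (n + e i) i = n i + 1 := by simp
  rw [hi] at h
  rw [act_apply, z_mul_mono, h]
  have h3 := sum_range_choose_succ (n i) (fun m => φ (mono (n + e i + (m : ℤ) • (e j - e i))) -
      ((n i + 1).negOnePow : ℤ) * φ' (mono (n + e i + (n i + 1 - m) • (e j - e i)))) B
  rw [h3, t1]
  have h4 : n + e i + (n i + 2) • (e j - e i) + ((B + 1 : ℕ) : ℤ) • (e i - e j) =
      n + e i + (n i + 1 - B) • (e j - e i) := by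
    push_cast; module
  rw [h4] at t2
  rw [t2]
  simp only [mul_zero, sub_zero, add_zero]
  refine Finset.sum_congr rfl fun m _ => ?_
  have h5 : n + e i + (((m + 1 : ℕ) : ℤ)) • (e j - e i) = n + (m : ℤ) • (e j - e i) + e j := by
    push_cast; module
  have h6 : n + e i + (n i + 1 - m) • (e j - e i) = n + (n i - m) • (e j - e i) + e j := by
    module
  have h7 : n + e i + (n i + 1 - (m + 1 : ℕ)) • (e j - e i) =
      n + (n i - m) • (e j - e i) + e i := by
    push_cast; module
  have h8 : n + e i + (m : ℤ) • (e j - e i) = n + (m : ℤ) • (e j - e i) + e i := by module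
  simp only [act_apply, sub_mul, z_mul_mono, map_sub, h5, h6, h7, h8, Int.negOnePow_succ]
  push_cast
  ring

theorem Compat.z_self {i j : Fin 3} (hij : i ≠ j) : Compat i j (z i) (z i + z j) := by
  simpa using Compat.z_sub_z.add (Compat.z_of_ne (j := j) hij.symm)

/-! ### Degree bounds in z_j after fusing two fields -/

/-- Laurent polynomials of degree at most `c` in `z j`. -/
noncomputable def degLE (j : Fin 3) (c : ℤ) : Submodule ℂ Laurent :=
  Submodule.span ℂ {f | ∃ n : Fin 3 → ℤ, n j ≤ c ∧ f = mono n}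

theorem mono_mem_degLE {j : Fin 3} {c : ℤ} {n : Fin 3 → ℤ} (h : n j ≤ c) : mono n ∈ degLE j c :=
  Submodule.subset_span ⟨n, h, rfl⟩

theorem degLE_mono {j : Fin 3} {c d : ℤ} (h : c ≤ d) : degLE j c ≤ degLE j d := by
  refine Submodule.span_mono ?_
  rintro _ ⟨n, hn, rfl⟩
  exact ⟨n, hn.trans h, rfl⟩

theorem mul_mem_degLE {j : Fin 3} {c d : ℤ} {f g : Laurent} (hf : f ∈ degLE j c)
    (hg : g ∈ degLE j d) : f * g ∈ degLE j (c + d) := by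
  have h := Submodule.mul_mem_mul hf hg
  rw [degLE, degLE, Submodule.span_mul_span] at h
  refine Submodule.span_le.2 ?_ h
  rintro _ ⟨_, ⟨n, hn, rfl⟩, _, ⟨m, hm, rfl⟩, rfl⟩
  simp only [mono_mul]
  exact mono_mem_degLE (by simp only [Pi.add_apply]; lia)

theorem one_mem_degLE (j : Fin 3) : (1 : Laurent) ∈ degLE j 0 := mono_mem_degLE (n := 0) (by simp)

theorem pow_mem_degLE {j : Fin 3} {c : ℤ} {f : Laurent} (hf : f ∈ degLE j c) (k : ℕ) :
    f ^ k ∈ degLE j (k * c) := by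
  induction k with
  | zero => simpa using one_mem_degLE j
  | succ k ih =>
    rw [pow_succ]
    convert mul_mem_degLE ih hf using 1
    push_cast; ring_nf

theorem z_mem_degLE_one (i j : Fin 3) : z i ∈ degLE j 1 :=
  mono_mem_degLE (by by_cases h : j = i <;> simp [h, e_ne])

theorem z_mem_degLE_zero {i j : Fin 3} (h : j ≠ i) : z i ∈ degLE j 0 :=
  mono_mem_degLE (by simp [e_ne h])

theorem apply_mul_mono_eq_zero {j : Fin 3} {c : ℤ} {g : Laurent} (hg : g ∈ degLE j c)
    {q : Laurent →ₗ[ℂ] ℂ} (hq : ∀ n : Fin 3 → ℤ, n j ≤ -2 → q (mono n) = 0)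
    {n : Fin 3 → ℤ} (hn : n j ≤ -2 - c) : q (g * mono n) = 0 := by
  induction hg using Submodule.span_induction with
  | mem x hx =>
    obtain ⟨m, hm, rfl⟩ := hx
    rw [mono_mul]
    exact hq _ (by simp only [Pi.add_apply]; lia)
  | zero => simp
  | add x y _ _ hx hy => rw [add_mul, map_add, hx, hy, add_zero]
  | smul c x _ hx => rw [smul_mul_assoc, map_smul, hx, smul_zero]

/-- The truncated expansion of `(z i - z j) ^ (n i)` times the remaining part of `z ^ n`. -/
noncomputable def expand (i j : Fin 3) (n : Fin 3 → ℤ) (B : ℕ) : Laurent :=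
  ∑ m ∈ Finset.range B,
    ((-1 : ℂ) ^ m * (Ring.choose (n i) m : ℤ)) • mono (n + (m : ℤ) • (e j - e i))

/-- The fused functional q dies at z_j-exponent ≤ -2, and multiplication by g' costs at most c in
that exponent. After clearing denominators both orderings coincide with h, so the relation speaks of
h alone. -/
theorem apply_expand_eventually_eq_zero {i j : Fin 3} (hij : i ≠ j) {c : ℤ} {g g' : Laurent}
    (hgg : Compat i j g g') (hg : g' ∈ degLE j c) {φ φ' q h : Laurent →ₗ[ℂ] ℂ}
    (hφ : Trunc (e j - e i) φ) (hφ' : Trunc (e i - e j) φ') (hrel : ExpRel i j φ φ' q)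
    (hq : ∀ n : Fin 3 → ℤ, n j ≤ -2 → q (mono n) = 0) (h1 : act g φ = h) (h2 : act g φ' = h)
    (hi : ∀ n : Fin 3 → ℤ, 0 ≤ n i → h (mono n) = 0) {n : Fin 3 → ℤ} (hn : n j ≤ -2 - c) :
    ∀ᶠ B : ℕ in atTop, h (expand i j n B) = 0 := by
  filter_upwards [hgg φ φ' q hφ hφ' hrel n] with B hB
  rw [act_apply, apply_mul_mono_eq_zero hg hq hn, h1, h2] at hB
  rw [hB, expand, map_sum]
  refine Finset.sum_congr rfl fun m _ => ?_
  -- In the opposite ordering z_i appears with exponent m ≥ 0, so that half contributes nothing.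
  rw [hi (n + (n i - m) • (e j - e i)) (by simp [e_ne hij]), map_smul, smul_eq_mul]
  ring

/-! ### The operators ∂_i + ∂_j -/

/-- The partial derivative with respect to `z i`. -/
noncomputable def D (i : Fin 3) : Module.End ℂ Laurent := liftMono fun n => (n i : ℂ) • mono (n - e i)

theorem D_mono (i : Fin 3) (n : Fin 3 → ℤ) : D i (mono n) = (n i : ℂ) • mono (n - e i) := by
  simp [D]

theorem commute_D (i j : Fin 3) : Commute (D i) (D j) := by
  rcases eq_or_ne i j with rfl | hij
  · exact Commute.refl _
  refine LinearMap.ext fun f => ?_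
  induction f using Laurent.induction with
  | hm n =>
    simp only [Module.End.mul_apply, D_mono, map_smul, Pi.sub_apply, e_ne hij, e_ne hij.symm,
      sub_zero, smul_smul, sub_right_comm]
    rw [mul_comm]
  | h0 => simp
  | ha f g hf hg => simp only [map_add, hf, hg]
  | hs c f hf => simp only [map_smul, hf]

/-- The sum of two partial derivatives. -/
noncomputable def pairD (i j : Fin 3) : Module.End ℂ Laurent := D i + D j

theorem pairD_mono (i j : Fin 3) (n : Fin 3 → ℤ) :
    pairD i j (mono n) = (n i : ℂ) • mono (n - e i) + (n j : ℂ) • mono (n - e j) := by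
  simp [pairD, D_mono]

theorem succ_mul_choose_succ (r : ℤ) (m : ℕ) :
    ((m : ℤ) + 1) * Ring.choose r (m + 1) = (r - m) * Ring.choose r m := by
  have h := Ring.descPochhammer_eq_factorial_smul_choose r (m + 1)
  have h' := Ring.descPochhammer_eq_factorial_smul_choose r m
  rw [descPochhammer_succ_right, Polynomial.smeval_mul, h', Nat.factorial_succ] at h
  simp [Polynomial.smeval_sub, Polynomial.smeval_natCast] at h
  have h0 : (m.factorial : ℤ) ≠ 0 := by exact_mod_cast m.factorial_ne_zero
  refine mul_left_cancel₀ h0 ?_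
  linear_combination -h

/-- ∂_i + ∂_j annihilates powers of z_i - z_j and so differentiates only the factor z_j^{n_j};
truncating the expansion leaves a single boundary monomial. -/
theorem pairD_expand {i j : Fin 3} (hij : i ≠ j) (n : Fin 3 → ℤ) (B : ℕ) :
    pairD i j (expand i j n B) = (n j : ℂ) • expand i j (n - e j) B -
      ((-1 : ℂ) ^ B * B * (Ring.choose (n i) B : ℤ)) •
        mono (n - e j + (B : ℤ) • (e j - e i)) := by
  induction B with
  | zero => simp [expand]
  | succ B ih =>
    have h1 := Finset.sum_range_succ (fun m : ℕ =>
      ((-1 : ℂ) ^ m * (Ring.choose (n i) m : ℤ)) • mono (n + (m : ℤ) • (e j - e i))) B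
    have h2 := Finset.sum_range_succ (fun m : ℕ => ((-1 : ℂ) ^ m *
      (Ring.choose ((n - e j) i) m : ℤ)) • mono (n - e j + (m : ℤ) • (e j - e i))) B
    have hi : (n - e j) i = n i := by simp [e_ne hij]
    have hc : ((B : ℂ) + 1) * (Ring.choose (n i) (B + 1) : ℤ) =
        (n i - B) * (Ring.choose (n i) B : ℤ) := by
      exact_mod_cast congrArg (Int.cast : ℤ → ℂ) (succ_mul_choose_succ (n i) B)
    rw [expand, h1, map_add, ← expand, ih, expand, expand, h2, map_smul, pairD_mono, hi]
    have h3 : n + (B : ℤ) • (e j - e i) - e i = n - e j + ((B + 1 : ℕ) : ℤ) • (e j - e i) := by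
      push_cast; module
    have h4 : n + (B : ℤ) • (e j - e i) - e j = n - e j + (B : ℤ) • (e j - e i) := by module
    have h5 : (n + (B : ℤ) • (e j - e i)) i = n i - B := by simp [e_ne hij, sub_eq_add_neg]
    have h6 : (n + (B : ℤ) • (e j - e i)) j = n j + B := by simp [e_ne hij.symm]
    rw [h3, h4, h5, h6]
    have h7 : (-1 : ℂ) ^ (B + 1) * ((B + 1 : ℕ) : ℂ) * (Ring.choose (n i) (B + 1) : ℤ) =
        - ((-1 : ℂ) ^ B * ((n i - B) * (Ring.choose (n i) B : ℤ))) := by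
      rw [← hc]; push_cast; ring
    rw [h7]
    push_cast
    module

theorem apply_pairD_pow_mono_eq_zero {i j : Fin 3} (hij : i ≠ j) {h : Laurent →ₗ[ℂ] ℂ}
    (hj : ∀ n : Fin 3 → ℤ, 0 ≤ n j → h (mono n) = 0) (k : ℕ) (n : Fin 3 → ℤ) (hn : (k : ℤ) ≤ n j) :
    h ((pairD i j ^ k) (mono n)) = 0 := by
  induction k generalizing n with
  | zero => simpa using hj n hn
  | succ k ih =>
    push_cast at hn
    rw [pow_succ, Module.End.mul_apply, pairD_mono, map_add, map_add, map_smul, map_smul,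
      map_smul, map_smul, ih, ih]
    · simp
    · simp only [Pi.sub_apply, e_same]; lia
    · simp only [Pi.sub_apply, e_ne hij.symm]; lia

theorem apply_pairD_pow_expand {i j : Fin 3} (hij : i ≠ j) {h : Laurent →ₗ[ℂ] ℂ}
    (hj : ∀ n : Fin 3 → ℤ, 0 ≤ n j → h (mono n) = 0) (k : ℕ) (n : Fin 3 → ℤ) :
    ∀ᶠ B : ℕ in atTop, h ((pairD i j ^ k) (expand i j n B)) =
      (∏ t ∈ Finset.range k, ((n j : ℂ) - t)) * h (expand i j (n - (k : ℤ) • e j) B) := by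
  induction k generalizing n with
  | zero => simp
  | succ k ih =>
    -- From this threshold on, the boundary monomial has z_j-exponent n_j - 1 + B ≥ k, so the
    -- remaining k derivatives cannot make the exponent negative.
    filter_upwards [ih (n - e j), eventually_ge_atTop (k + 1 - n j).toNat] with B hB hB'
    rw [pow_succ, Module.End.mul_apply, pairD_expand hij, map_sub, map_sub, map_smul, map_smul,
      map_smul, map_smul, hB, apply_pairD_pow_mono_eq_zero hij hj, Finset.prod_range_succ']
    · have h1 : n - e j - (k : ℤ) • e j = n - ((k + 1 : ℕ) : ℤ) • e j := by push_cast; module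
      rw [h1]
      simp [sub_sub, add_comm (1 : ℂ)]
      ring
    · simp [e_ne hij.symm]; lia

/-- On an expansion, c + 1 derivatives lower n_j by c + 1. A negative n_j lands in the range of
`hexp`; for 0 ≤ n_j ≤ c the derivative of z_j^{n_j} is zero; for larger n_j the exponent stays
nonnegative. Monomials follow by descending induction on n_j, since an expansion is its leading
monomial plus terms with larger z_j-exponent. -/
theorem apply_pairD_pow_eq_zero {i j : Fin 3} (hij : i ≠ j) {h : Laurent →ₗ[ℂ] ℂ} (c : ℕ)
    (hj : ∀ n : Fin 3 → ℤ, 0 ≤ n j → h (mono n) = 0)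
    (hexp : ∀ n : Fin 3 → ℤ, n j ≤ -2 - c → ∀ᶠ B : ℕ in atTop, h (expand i j n B) = 0)
    (f : Laurent) : h ((pairD i j ^ (c + 1)) f) = 0 := by
  have key : ∀ n : Fin 3 → ℤ, ∀ᶠ B : ℕ in atTop,
      h ((pairD i j ^ (c + 1)) (expand i j n B)) = 0 := by
    intro n
    rcases lt_or_ge (n j) 0 with hn | hn
    · filter_upwards [apply_pairD_pow_expand hij hj (c + 1) n,
        hexp (n - ((c + 1 : ℕ) : ℤ) • e j) (by simp; lia)] with B h1 h2
      rw [h1, h2, mul_zero]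
    · filter_upwards [apply_pairD_pow_expand hij hj (c + 1) n] with B h1
      rw [h1]
      rcases lt_or_ge (n j) (c + 1) with hc | hc
      · obtain ⟨t, ht⟩ := Int.eq_ofNat_of_zero_le hn
        rw [Finset.prod_eq_zero (i := t) (by simp; lia) (by simp [ht]), zero_mul]
      · rw [expand, map_sum, Finset.sum_eq_zero, mul_zero]
        intro m _
        rw [map_smul, hj, smul_zero]
        simp [e_ne hij.symm]; lia
  have hmono : ∀ (k : ℕ) (n : Fin 3 → ℤ), (c + 1 - n j).toNat ≤ k →
      h ((pairD i j ^ (c + 1)) (mono n)) = 0 := by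
    intro k
    induction k with
    | zero =>
      intro n hn
      exact apply_pairD_pow_mono_eq_zero hij hj _ _ (by push_cast; lia)
    | succ k ih =>
      intro n hn
      obtain ⟨B, hB, hB'⟩ := ((key n).and (eventually_ge_atTop 1)).exists
      obtain ⟨B, rfl⟩ := Nat.exists_eq_add_of_le' hB'
      rw [expand, Finset.sum_range_succ', map_add, map_add, map_sum, map_sum,
        Finset.sum_eq_zero] at hB
      · simpa using hB
      · intro m _
        rw [map_smul, map_smul, ih, smul_zero]
        simp [e_ne hij.symm]; lia
  induction f using Laurent.induction with
  | hm n => exact hmono _ n le_rfl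
  | h0 => simp
  | ha f g hf hg => rw [map_add, map_add, hf, hg, add_zero]
  | hs c f hf => rw [map_smul, map_smul, hf, smul_zero]

/-! ### Clearing poles by polynomial factors -/

/-- The polynomials among the Laurent polynomials, characterized by their action on functionals
vanishing on monomials with sufficiently large exponents. -/
def IsPoly (g : Laurent) : Prop :=
  ∀ (S : Set (Fin 3 → ℤ)) (_ : ∀ n ∈ S, ∀ i, n + e i ∈ S) (ψ : Laurent →ₗ[ℂ] ℂ)
    (_ : ∀ n ∈ S, ψ (mono n) = 0), ∀ n ∈ S, ψ (g * mono n) = 0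

theorem isPoly_z (i : Fin 3) : IsPoly (z i) := by
  intro S hS ψ hψ n hn
  rw [z_mul_mono]
  exact hψ _ (hS n hn i)

theorem IsPoly.sub {f g : Laurent} (hf : IsPoly f) (hg : IsPoly g) : IsPoly (f - g) := by
  intro S hS ψ hψ n hn
  rw [sub_mul, map_sub, hf S hS ψ hψ n hn, hg S hS ψ hψ n hn, sub_zero]

theorem IsPoly.mul {f g : Laurent} (hf : IsPoly f) (hg : IsPoly g) : IsPoly (f * g) := by
  intro S hS ψ hψ n hn
  rw [mul_assoc, ← act_apply]
  exact hg S hS _ (hf S hS ψ hψ) n hn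

theorem IsPoly.pow {f : Laurent} (hf : IsPoly f) (k : ℕ) : IsPoly (f ^ k) := by
  induction k with
  | zero => intro S hS ψ hψ n hn; simpa using hψ n hn
  | succ k ih => rw [pow_succ]; exact ih.mul hf

theorem isPoly_z_sub_z (i j : Fin 3) : IsPoly (z i - z j) := (isPoly_z i).sub (isPoly_z j)

theorem z_pow_mul_mono (i : Fin 3) (k : ℕ) (n : Fin 3 → ℤ) :
    z i ^ k * mono n = mono (n + (k : ℤ) • e i) := by
  induction k with
  | zero => simp
  | succ k ih =>
    rw [pow_succ', mul_assoc, ih, z_mul_mono]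
    congr 1
    push_cast; module

theorem IsPoly.apply_z_pow_mul_eq_zero {g : Laurent} (hg : IsPoly g) {k : Fin 3} {M : ℕ}
    {ψ : Laurent →ₗ[ℂ] ℂ} (hψ : ∀ n : Fin 3 → ℤ, (M : ℤ) ≤ n k → ψ (mono n) = 0)
    {n : Fin 3 → ℤ} (hn : 0 ≤ n k) : ψ (g * z k ^ M * mono n) = 0 := by
  rw [mul_assoc, z_pow_mul_mono]
  refine hg {n | (M : ℤ) ≤ n k} ?_ ψ hψ _ (by simpa using hn)
  intro n hn i
  simp only [Set.mem_ofPred_eq, Pi.add_apply] at hn ⊢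
  by_cases h : k = i
  · subst h; simp; lia
  · simpa [e_ne h] using hn

/-! ### Bounding the total degree of the numerator -/

section Vanishing

variable {h : Laurent →ₗ[ℂ] ℂ} {c₁ c₂ c₃ : ℕ}

/-- A monomial in the three operators `∂ᵢ + ∂ⱼ`. -/
noncomputable def pairDMono (a b c : ℕ) : Module.End ℂ Laurent :=
  pairD 0 1 ^ a * pairD 0 2 ^ b * pairD 1 2 ^ c

theorem commute_pairD (i j k l : Fin 3) : Commute (pairD i j) (pairD k l) :=
  ((commute_D i k).add_left (commute_D j k)).add_right ((commute_D i l).add_left (commute_D j l))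

theorem pairDMono_mul_01 (a b c : ℕ) : pairDMono a b c * pairD 0 1 = pairDMono (a + 1) b c := by
  have h1 := (commute_pairD 0 1 0 2).pow_right b
  have h2 := (commute_pairD 0 1 1 2).pow_right c
  rw [pairDMono, pairDMono, mul_assoc, ← h2.eq, ← mul_assoc, mul_assoc (pairD 0 1 ^ a), ← h1.eq,
    ← mul_assoc, pow_succ]

theorem pairDMono_mul_02 (a b c : ℕ) : pairDMono a b c * pairD 0 2 = pairDMono a (b + 1) c := by
  have h2 := (commute_pairD 0 2 1 2).pow_right c
  rw [pairDMono, pairDMono, mul_assoc, ← h2.eq, ← mul_assoc, mul_assoc (pairD 0 1 ^ a), pow_succ]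

theorem pairDMono_mul_12 (a b c : ℕ) : pairDMono a b c * pairD 1 2 = pairDMono a b (c + 1) := by
  rw [pairDMono, pairDMono, mul_assoc, pow_succ]

theorem apply_pairDMono_eq_zero (h1 : ∀ f, h ((pairD 0 1 ^ (c₁ + 1)) f) = 0)
    (h2 : ∀ f, h ((pairD 0 2 ^ (c₂ + 1)) f) = 0) (h3 : ∀ f, h ((pairD 1 2 ^ (c₃ + 1)) f) = 0)
    {a b c : ℕ} (habc : c₁ < a ∨ c₂ < b ∨ c₃ < c) (f : Laurent) : h (pairDMono a b c f) = 0 := by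
  rcases habc with h0 | h0 | h0
  · obtain ⟨k, rfl⟩ := Nat.exists_eq_add_of_le h0
    rw [pairDMono, mul_assoc, pow_add, mul_assoc, Module.End.mul_apply]
    exact h1 _
  · obtain ⟨k, rfl⟩ := Nat.exists_eq_add_of_le h0
    rw [pairDMono, ((commute_pairD 0 1 0 2).pow_pow a _).eq, pow_add, mul_assoc, mul_assoc,
      Module.End.mul_apply]
    exact h2 _
  · obtain ⟨k, rfl⟩ := Nat.exists_eq_add_of_le h0
    rw [pairDMono, ((((commute_pairD 0 1 1 2).pow_left a).mul_left
      ((commute_pairD 0 2 1 2).pow_left b)).pow_right _).eq, pow_add, mul_assoc,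
      Module.End.mul_apply]
    exact h3 _

theorem exists_D_eq_sum_pairD (l : Fin 3) : ∃ s : Fin 3 → ℂ,
    D l = s 0 • pairD 0 1 + s 1 • pairD 0 2 + s 2 • pairD 1 2 := by
  fin_cases l
  · refine ⟨![1 / 2, 1 / 2, -1 / 2], ?_⟩
    simp [pairD]; module
  · refine ⟨![1 / 2, -1 / 2, 1 / 2], ?_⟩
    simp [pairD]; module
  · refine ⟨![-1 / 2, 1 / 2, 1 / 2], ?_⟩
    simp [pairD]; module

/-- Up to sign, the values at `mono (-1)` are constant terms of derivatives of the numerator. A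
monomial of lower degree is a nonzero multiple of some ∂_l of a monomial one degree higher, and ∂_l
is a combination of the ∂_i + ∂_j; each step trades one degree for one more derivative. -/
theorem apply_pairDMono_mono_eq_zero {C : ℕ}
    (hbase : ∀ a b c, C ≤ a + b + c → h (pairDMono a b c (mono (-1))) = 0) (k : ℕ) :
    ∀ (a b c : ℕ) (n : Fin 3 → ℤ), (∀ i, n i < 0) → n 0 + n 1 + n 2 = -3 - k →
      C ≤ a + b + c + k → h (pairDMono a b c (mono n)) = 0 := by
  induction k with
  | zero =>
    intro a b c n hn hs habc
    have : n = -1 := by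
      have h0 := hn 0
      have h1 := hn 1
      have h2 := hn 2
      push_cast at hs
      funext i
      fin_cases i <;> simp <;> lia
    rw [this]
    exact hbase a b c habc
  | succ k ih =>
    intro a b c n hn hs habc
    -- An exponent ≤ -2 is needed because z_l^{-1} is not a derivative.
    obtain ⟨l, hl⟩ : ∃ l, n l ≤ -2 := by
      by_contra! hc
      have h0 := hc 0
      have h1 := hc 1
      have h2 := hc 2
      push_cast at hs
      lia
    have hD : mono n = ((n l + 1 : ℤ) : ℂ)⁻¹ • D l (mono (n + e l)) := by
      rw [D_mono]
      have : ((n l + 1 : ℤ) : ℂ) ≠ 0 := by exact_mod_cast (by lia)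
      have h2 : (((n + e l) l : ℤ) : ℂ) = ((n l + 1 : ℤ) : ℂ) := by simp
      rw [h2, smul_smul, inv_mul_cancel₀ this, one_smul, add_sub_cancel_right]
    have hn' : ∀ i, (n + e l) i < 0 := by
      intro i
      by_cases hi : i = l
      · subst hi; simp; lia
      · simpa [e_ne hi] using hn i
    have hs' : (n + e l) 0 + (n + e l) 1 + (n + e l) 2 = -3 - k := by
      have : e l 0 + e l 1 + e l 2 = 1 := by fin_cases l <;> simp [e]
      simp only [Pi.add_apply]; push_cast at hs; lia
    obtain ⟨s, hs2⟩ := exists_D_eq_sum_pairD l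
    have h01 := ih (a + 1) b c _ hn' hs' (by lia)
    have h02 := ih a (b + 1) c _ hn' hs' (by lia)
    have h12 := ih a b (c + 1) _ hn' hs' (by lia)
    rw [← pairDMono_mul_01, Module.End.mul_apply] at h01
    rw [← pairDMono_mul_02, Module.End.mul_apply] at h02
    rw [← pairDMono_mul_12, Module.End.mul_apply] at h12
    rw [hD, hs2]
    simp [h01, h02, h12]

theorem apply_mono_eq_zero_of_sum_le {C : ℕ}
    (hbase : ∀ a b c, C ≤ a + b + c → h (pairDMono a b c (mono (-1))) = 0)
    (hpos : ∀ i (n : Fin 3 → ℤ), 0 ≤ n i → h (mono n) = 0) {n : Fin 3 → ℤ}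
    (hn : n 0 + n 1 + n 2 ≤ -3 - C) : h (mono n) = 0 := by
  by_cases hneg : ∀ i, n i < 0
  · have := apply_pairDMono_mono_eq_zero hbase (-3 - (n 0 + n 1 + n 2)).toNat 0 0 0 n hneg
      (by lia) (by lia)
    simpa [pairDMono] using this
  · push Not at hneg
    obtain ⟨i, hi⟩ := hneg
    exact hpos i n hi

theorem D_pow_mono (k : ℕ) : ∃ s : ℂ,
    (D 0 ^ k) (mono (-1)) = s • mono (-1 - (k : ℤ) • e 0) := by
  induction k with
  | zero => exact ⟨1, by simp⟩
  | succ k ih =>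
    obtain ⟨s, hs⟩ := ih
    refine ⟨s * ((-1 - (k : ℤ) • e 0) 0 : ℤ), ?_⟩
    rw [pow_succ', Module.End.mul_apply, hs, map_smul, D_mono, smul_smul]
    congr 2
    push_cast; module

theorem pairD_pow_mul_eq_smul_pairDMono (a b c p q : ℕ) :
    pairD 0 1 ^ a * pairD 0 2 ^ b * (p : Module.End ℂ Laurent) * ((-1 : ℂ) • pairD 1 2) ^ c *
      (q : Module.End ℂ Laurent) = ((p : ℂ) * (-1) ^ c * (q : ℂ)) • pairDMono a b c := by
  simp only [pairDMono, smul_pow, ← Nat.cast_smul_eq_nsmul ℂ, ← nsmul_eq_mul',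
    smul_mul_assoc, mul_smul_comm, smul_smul]
  congr 1; ring

/-- Expand (2∂_0)^C = ((∂_0 + ∂_1) + (∂_0 + ∂_2) - (∂_1 + ∂_2))^C with C = c₁ + c₂ + c₃. Every
monomial but the critical one exceeds some bound c_i, and the critical one has a nonzero multinomial
coefficient. Thus the coefficient of z_0^C alone controls the top degree. -/
theorem apply_pairDMono_critical (h1 : ∀ f, h ((pairD 0 1 ^ (c₁ + 1)) f) = 0)
    (h2 : ∀ f, h ((pairD 0 2 ^ (c₂ + 1)) f) = 0) (h3 : ∀ f, h ((pairD 1 2 ^ (c₃ + 1)) f) = 0)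
    (h0 : h (mono (-1 - ((c₁ + c₂ + c₃ : ℕ) : ℤ) • e 0)) = 0) :
    h (pairDMono c₁ c₂ c₃ (mono (-1))) = 0 := by
  have hsum : pairD 0 1 + pairD 0 2 + (-1 : ℂ) • pairD 1 2 = (2 : ℂ) • D 0 := by
    simp only [pairD]; module
  have hcomm : Commute (pairD 0 1 + pairD 0 2) ((-1 : ℂ) • pairD 1 2) :=
    ((commute_pairD 0 1 1 2).add_left (commute_pairD 0 2 1 2)).smul_right _
  obtain ⟨s, hs⟩ := D_pow_mono (c₁ + c₂ + c₃)
  have hz : h (((pairD 0 1 + pairD 0 2 + (-1 : ℂ) • pairD 1 2) ^ (c₁ + c₂ + c₃)) (mono (-1))) =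
      0 := by
    rw [hsum, smul_pow, LinearMap.smul_apply, hs, map_smul, map_smul, h0, smul_zero, smul_zero]
  rw [hcomm.add_pow, LinearMap.sum_apply, map_sum, Finset.sum_eq_single (c₁ + c₂)] at hz
  · rw [(commute_pairD 0 1 0 2).add_pow, Finset.sum_mul, Finset.sum_mul, LinearMap.sum_apply,
      map_sum, Finset.sum_eq_single c₁] at hz
    · have e1 : c₁ + c₂ - c₁ = c₂ := by lia
      have e2 : c₁ + c₂ + c₃ - (c₁ + c₂) = c₃ := by lia
      rw [e1, e2, pairD_pow_mul_eq_smul_pairDMono, LinearMap.smul_apply, map_smul, smul_eq_zero] at hz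
      refine hz.resolve_left ?_
      have p1 : ((c₁ + c₂).choose c₁ : ℂ) ≠ 0 := by
        exact_mod_cast (Nat.choose_pos (by lia)).ne'
      have p2 : ((c₁ + c₂ + c₃).choose (c₁ + c₂) : ℂ) ≠ 0 := by
        exact_mod_cast (Nat.choose_pos (by lia)).ne'
      have p3 : (-1 : ℂ) ^ c₃ ≠ 0 := pow_ne_zero _ (by norm_num)
      exact mul_ne_zero (mul_ne_zero p1 p3) p2
    · intro l hl hne
      rw [Finset.mem_range] at hl
      rw [pairD_pow_mul_eq_smul_pairDMono, LinearMap.smul_apply, map_smul,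
        apply_pairDMono_eq_zero h1 h2 h3 (by lia), smul_zero]
    · intro hl
      exact absurd (Finset.mem_range.2 (by lia)) hl
  · intro k hk hne
    rw [Finset.mem_range] at hk
    rw [(commute_pairD 0 1 0 2).add_pow, Finset.sum_mul, Finset.sum_mul, LinearMap.sum_apply,
      map_sum, Finset.sum_eq_zero]
    intro l hl
    rw [Finset.mem_range] at hl
    rw [pairD_pow_mul_eq_smul_pairDMono, LinearMap.smul_apply, map_smul,
        apply_pairDMono_eq_zero h1 h2 h3 (by lia), smul_zero]
  · intro hl
    exact absurd (Finset.mem_range.2 (by lia)) hl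

end Vanishing

/-! ### Cancelling the denominator -/

/-- The functionals for which divisibility by `z i - z j`, `i < j`, can be cancelled. -/
def IsOrdered (ψ : Laurent →ₗ[ℂ] ℂ) : Prop := ∀ i j : Fin 3, i < j → Trunc (e j - e i) ψ

/-- Multiplication by `g`, which is homogeneous of degree `d`, can be cancelled. -/
def Cancel (g : Laurent) (d : ℤ) : Prop :=
  ∀ ψ, IsOrdered ψ → ∀ K : ℤ, (∀ n : Fin 3 → ℤ, n 0 + n 1 + n 2 ≤ K → ψ (g * mono n) = 0) →
    ∀ n : Fin 3 → ℤ, n 0 + n 1 + n 2 ≤ K + d → ψ (mono n) = 0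

theorem Cancel.mul {g g' : Laurent} {d d' : ℤ} (h : Cancel g d) (h' : Cancel g' d') :
    Cancel (g * g') (d + d') := by
  intro ψ hψ K hK n hn
  refine h ψ hψ (K + d') (h' (act g ψ) (fun i j hij => (hψ i j hij).act g) K ?_) n (by lia)
  intro n hn
  rw [act_apply, ← mul_assoc]
  exact hK n hn

theorem Cancel.pow {g : Laurent} {d : ℤ} (h : Cancel g d) (k : ℕ) : Cancel (g ^ k) (k * d) := by
  induction k with
  | zero => intro ψ hψ K hK n hn; simpa using hK n (by simpa using hn)
  | succ k ih =>
    rw [pow_succ]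
    convert ih.mul h using 1
    push_cast; ring

theorem sum_e (i : Fin 3) : e i 0 + e i 1 + e i 2 = 1 := by fin_cases i <;> simp [e]

theorem Cancel.z (i : Fin 3) : Cancel (z i) 1 := by
  intro ψ hψ K hK n hn
  have h1 := sum_e i
  have := hK (n - e i) (by simp only [Pi.sub_apply]; lia)
  simpa [z_mul_mono] using this

/-- In the given degrees ψ is constant along the direction e_j - e_i, and truncation in that
direction forces the constant to be zero. -/
theorem Cancel.z_sub_z {i j : Fin 3} (hij : i < j) : Cancel (Laurent.z i - Laurent.z j) 1 := by
  intro ψ hψ K hK n hn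
  have h1 := sum_e i
  have h2 := sum_e j
  have key : ∀ m : ℕ, ψ (mono (n + (m : ℤ) • (e j - e i))) = ψ (mono n) := by
    intro m
    induction m with
    | zero => simp
    | succ m ih =>
      have h3 := hK (n + (m : ℤ) • (e j - e i) - e i) (by
        have : (m : ℤ) * (e j 0 - e i 0) + m * (e j 1 - e i 1) + m * (e j 2 - e i 2) = 0 := by
          linear_combination (m : ℤ) * (h2 - h1)
        simp only [Pi.sub_apply, Pi.add_apply, Pi.smul_apply, smul_eq_mul]; lia)
      rw [sub_mul, map_sub, z_mul_mono, z_mul_mono, sub_add_cancel, ih, sub_eq_zero] at h3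
      rw [h3]
      congr 2
      push_cast; module
  obtain ⟨m, hm⟩ := (hψ i j hij n).exists
  rw [← key m, hm]

/-! ### Abstract four-point functions -/

/-- Functionals on Laurent polynomials which behave like the six orderings of the modes in a
correlation function of four odd fields, the last one sitting at the origin. -/
structure Correlator where
  /-- The functional for a given ordering. -/
  φ : Fin 3 → Fin 3 → Fin 3 → Laurent →ₗ[ℂ] ℂ
  /-- The pole orders between the first three fields. -/
  N : Fin 3 → Fin 3 → ℕ
  /-- The pole orders at the origin. -/
  M : Fin 3 → ℕ
  locality_outer : ∀ i j k, i ≠ j → i ≠ k → j ≠ k → ∀ f,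
    φ i j k ((z i - z j) ^ N i j * f) = φ j i k ((z i - z j) ^ N i j * f)
  locality_inner : ∀ i j k, i ≠ j → i ≠ k → j ≠ k → ∀ f,
    φ i j k ((z j - z k) ^ N j k * f) = φ i k j ((z j - z k) ^ N j k * f)
  trunc_inner : ∀ i j k, i ≠ j → i ≠ k → j ≠ k → ∀ n : Fin 3 → ℤ, (M k : ℤ) ≤ n k →
    φ i j k (mono n) = 0
  trunc_outer : ∀ i j k, i ≠ j → i ≠ k → j ≠ k → Trunc (e j - e i) (φ i j k)
  expRel : ∀ i j k, i ≠ j → i ≠ k → j ≠ k → ∃ q : Laurent →ₗ[ℂ] ℂ,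
    ExpRel i j (φ i j k) (φ j i k) q ∧ ∀ n : Fin 3 → ℤ, n j ≤ -2 → q (mono n) = 0

namespace Correlator

variable (P : Correlator)

/-- The product of all denominators. -/
noncomputable def denom : Laurent :=
  (z 0 - z 1) ^ P.N 0 1 * (z 0 - z 2) ^ P.N 0 2 * (z 1 - z 2) ^ P.N 1 2 *
    z 0 ^ P.M 0 * z 1 ^ P.M 1 * z 2 ^ P.M 2

/-- The sum of all pole orders. -/
def total : ℕ := P.N 0 1 + P.N 0 2 + P.N 1 2 + P.M 0 + P.M 1 + P.M 2

theorem cancel_denom : Cancel P.denom P.total := by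
  have h := (((((Cancel.z_sub_z (i := 0) (j := 1) (by decide)).pow (P.N 0 1)).mul
    ((Cancel.z_sub_z (i := 0) (j := 2) (by decide)).pow (P.N 0 2))).mul
    ((Cancel.z_sub_z (i := 1) (j := 2) (by decide)).pow (P.N 1 2))).mul
    ((Cancel.z 0).pow (P.M 0))).mul ((Cancel.z 1).pow (P.M 1)) |>.mul ((Cancel.z 2).pow (P.M 2))
  have ht : (P.total : ℤ) = P.N 0 1 * 1 + P.N 0 2 * 1 + P.N 1 2 * 1 + P.M 0 * 1 + P.M 1 * 1 +
      P.M 2 * 1 := by simp only [total]; push_cast; ring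
  rw [ht]
  exact h

/-- The polynomial obtained by clearing denominators. -/
noncomputable def cleared : Laurent →ₗ[ℂ] ℂ := act P.denom (P.φ 0 1 2)

theorem act_outer {i j k : Fin 3} (hij : i ≠ j) (hik : i ≠ k) (hjk : j ≠ k) {g : Laurent}
    (hg : P.denom = (z i - z j) ^ P.N i j * g) : act P.denom (P.φ i j k) = act P.denom (P.φ j i k) := by
  refine LinearMap.ext fun f => ?_
  rw [act_apply, act_apply, hg, mul_assoc, P.locality_outer i j k hij hik hjk]

theorem act_inner {i j k : Fin 3} (hij : i ≠ j) (hik : i ≠ k) (hjk : j ≠ k) {g : Laurent}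
    (hg : P.denom = (z j - z k) ^ P.N j k * g) : act P.denom (P.φ i j k) = act P.denom (P.φ i k j) := by
  refine LinearMap.ext fun f => ?_
  rw [act_apply, act_apply, hg, mul_assoc, P.locality_inner i j k hij hik hjk]

theorem denom_eq_01 : P.denom = (z 0 - z 1) ^ P.N 0 1 * ((z 0 - z 2) ^ P.N 0 2 *
    (z 1 - z 2) ^ P.N 1 2 * z 0 ^ P.M 0 * z 1 ^ P.M 1 * z 2 ^ P.M 2) := by
  rw [denom]; ring

theorem denom_eq_02 : P.denom = (z 0 - z 2) ^ P.N 0 2 * ((z 0 - z 1) ^ P.N 0 1 *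
    (z 1 - z 2) ^ P.N 1 2 * z 0 ^ P.M 0 * z 1 ^ P.M 1 * z 2 ^ P.M 2) := by
  rw [denom]; ring

theorem denom_eq_12 : P.denom = (z 1 - z 2) ^ P.N 1 2 * ((z 0 - z 1) ^ P.N 0 1 *
    (z 0 - z 2) ^ P.N 0 2 * z 0 ^ P.M 0 * z 1 ^ P.M 1 * z 2 ^ P.M 2) := by
  rw [denom]; ring

theorem act_102 : act P.denom (P.φ 1 0 2) = P.cleared :=
  (P.act_outer (by decide) (by decide) (by decide) P.denom_eq_01).symm

theorem act_021 : act P.denom (P.φ 0 2 1) = P.cleared :=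
  (P.act_inner (by decide) (by decide) (by decide) P.denom_eq_12).symm

theorem act_120 : act P.denom (P.φ 1 2 0) = P.cleared :=
  (P.act_inner (by decide) (by decide) (by decide) P.denom_eq_02).symm.trans P.act_102

theorem act_201 : act P.denom (P.φ 2 0 1) = P.cleared :=
  (P.act_outer (by decide) (by decide) (by decide) P.denom_eq_02).symm.trans P.act_021

theorem act_210 : act P.denom (P.φ 2 1 0) = P.cleared :=
  (P.act_outer (by decide) (by decide) (by decide) P.denom_eq_12).symm.trans P.act_120

/-- All orderings agree once the denominator is cleared, so one may put the field i innermost; there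
z_i^{M_i} moves the exponent past the truncation order. -/
theorem cleared_mono_eq_zero (i : Fin 3) (n : Fin 3 → ℤ) (hn : 0 ≤ n i) :
    P.cleared (mono n) = 0 := by
  have h01 := (isPoly_z_sub_z 0 1).pow (P.N 0 1)
  have h02 := (isPoly_z_sub_z 0 2).pow (P.N 0 2)
  have h12 := (isPoly_z_sub_z 1 2).pow (P.N 1 2)
  have h0 := (isPoly_z 0).pow (P.M 0)
  have h1 := (isPoly_z 1).pow (P.M 1)
  have h2 := (isPoly_z 2).pow (P.M 2)
  have hp := (h01.mul h02).mul h12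
  obtain rfl | rfl | rfl : i = 0 ∨ i = 1 ∨ i = 2 := by fin_cases i <;> simp
  · rw [← P.act_120, act_apply]
    convert ((hp.mul h1).mul h2).apply_z_pow_mul_eq_zero
      (P.trunc_inner 1 2 0 (by decide) (by decide) (by decide)) hn using 3
    rw [denom]; ring
  · rw [← P.act_021, act_apply]
    convert ((hp.mul h0).mul h2).apply_z_pow_mul_eq_zero
      (P.trunc_inner 0 2 1 (by decide) (by decide) (by decide)) hn using 3
    rw [denom]; ring
  · rw [cleared, act_apply]
    exact ((hp.mul h0).mul h1).apply_z_pow_mul_eq_zero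
      (P.trunc_inner 0 1 2 (by decide) (by decide) (by decide)) hn

theorem cleared_pairD {i j k : Fin 3} (hij : i ≠ j) (hik : i ≠ k) (hjk : j ≠ k) {g' : Laurent}
    (hc : Compat i j P.denom g') {c : ℕ} (hg' : g' ∈ degLE j c)
    (h1 : act P.denom (P.φ i j k) = P.cleared) (h2 : act P.denom (P.φ j i k) = P.cleared)
    (f : Laurent) : P.cleared ((pairD i j ^ (c + 1)) f) = 0 := by
  obtain ⟨q, hq, hq'⟩ := P.expRel i j k hij hik hjk
  exact apply_pairD_pow_eq_zero hij c (P.cleared_mono_eq_zero j)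
    (fun n hn => apply_expand_eventually_eq_zero hij hc hg' (P.trunc_outer i j k hij hik hjk)
      (P.trunc_outer j i k hij.symm hjk hik) hq hq' h1 h2 (P.cleared_mono_eq_zero i) hn) f

theorem cleared_pairD_01 (f : Laurent) :
    P.cleared ((pairD 0 1 ^ (P.N 0 2 + P.N 1 2 + P.M 0 + P.M 1 + 1)) f) = 0 := by
  have c0 : Compat 0 1 (z 0) (z 0 + z 1) := Compat.z_self (by decide)
  have c1 : Compat 0 1 (z 1) (z 1) := Compat.z_of_ne (by decide)
  have c2 : Compat 0 1 (z 2) (z 2) := Compat.z_of_ne (by decide)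
  refine P.cleared_pairD (k := 2) (by decide) (by decide) (by decide)
    (((((Compat.z_sub_z.pow _).mul ((c0.sub c2).pow _)).mul ((c1.sub c2).pow _)).mul
      (c0.pow _)).mul (c1.pow _) |>.mul (c2.pow _)) ?_ rfl P.act_102 f
  have d0 : z 0 ∈ degLE 1 0 := z_mem_degLE_zero (by decide)
  have d1 : z 1 ∈ degLE 1 1 := z_mem_degLE_one _ _
  have d2 : z 2 ∈ degLE 1 0 := z_mem_degLE_zero (by decide)
  have l := degLE_mono (j := 1) (show (0 : ℤ) ≤ 1 by decide)
  refine degLE_mono (le_of_eq ?_) (mul_mem_degLE (mul_mem_degLE (mul_mem_degLE (mul_mem_degLE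
    (mul_mem_degLE (pow_mem_degLE d0 _)
      (pow_mem_degLE (Submodule.sub_mem _ (Submodule.add_mem _ (l d0) d1) (l d2)) _))
      (pow_mem_degLE (Submodule.sub_mem _ d1 (l d2)) _))
      (pow_mem_degLE (Submodule.add_mem _ (l d0) d1) _)) (pow_mem_degLE d1 _))
      (pow_mem_degLE d2 _))
  push_cast; ring

theorem cleared_pairD_02 (f : Laurent) :
    P.cleared ((pairD 0 2 ^ (P.N 0 1 + P.N 1 2 + P.M 0 + P.M 2 + 1)) f) = 0 := by
  have c0 : Compat 0 2 (z 0) (z 0 + z 2) := Compat.z_self (by decide)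
  have c1 : Compat 0 2 (z 1) (z 1) := Compat.z_of_ne (by decide)
  have c2 : Compat 0 2 (z 2) (z 2) := Compat.z_of_ne (by decide)
  refine P.cleared_pairD (k := 1) (by decide) (by decide) (by decide)
    ((((((c0.sub c1).pow _).mul (Compat.z_sub_z.pow _)).mul ((c1.sub c2).pow _)).mul
      (c0.pow _)).mul (c1.pow _) |>.mul (c2.pow _)) ?_ P.act_021 P.act_201 f
  have d0 : z 0 ∈ degLE 2 0 := z_mem_degLE_zero (by decide)
  have d1 : z 1 ∈ degLE 2 0 := z_mem_degLE_zero (by decide)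
  have d2 : z 2 ∈ degLE 2 1 := z_mem_degLE_one _ _
  have l := degLE_mono (j := 2) (show (0 : ℤ) ≤ 1 by decide)
  refine degLE_mono (le_of_eq ?_) (mul_mem_degLE (mul_mem_degLE (mul_mem_degLE (mul_mem_degLE
    (mul_mem_degLE
      (pow_mem_degLE (Submodule.sub_mem _ (Submodule.add_mem _ (l d0) d2) (l d1)) _)
      (pow_mem_degLE d0 _))
      (pow_mem_degLE (Submodule.sub_mem _ (l d1) d2) _))
      (pow_mem_degLE (Submodule.add_mem _ (l d0) d2) _)) (pow_mem_degLE d1 _))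
      (pow_mem_degLE d2 _))
  push_cast; ring

theorem cleared_pairD_12 (f : Laurent) :
    P.cleared ((pairD 1 2 ^ (P.N 0 1 + P.N 0 2 + P.M 1 + P.M 2 + 1)) f) = 0 := by
  have c0 : Compat 1 2 (z 0) (z 0) := Compat.z_of_ne (by decide)
  have c1 : Compat 1 2 (z 1) (z 1 + z 2) := Compat.z_self (by decide)
  have c2 : Compat 1 2 (z 2) (z 2) := Compat.z_of_ne (by decide)
  refine P.cleared_pairD (k := 0) (by decide) (by decide) (by decide)
    ((((((c0.sub c1).pow _).mul ((c0.sub c2).pow _)).mul (Compat.z_sub_z.pow _)).mul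
      (c0.pow _)).mul (c1.pow _) |>.mul (c2.pow _)) ?_ P.act_120 P.act_210 f
  have d0 : z 0 ∈ degLE 2 0 := z_mem_degLE_zero (by decide)
  have d1 : z 1 ∈ degLE 2 0 := z_mem_degLE_zero (by decide)
  have d2 : z 2 ∈ degLE 2 1 := z_mem_degLE_one _ _
  have l := degLE_mono (j := 2) (show (0 : ℤ) ≤ 1 by decide)
  refine degLE_mono (le_of_eq ?_) (mul_mem_degLE (mul_mem_degLE (mul_mem_degLE (mul_mem_degLE
    (mul_mem_degLE
      (pow_mem_degLE (Submodule.sub_mem _ (l d0) (Submodule.add_mem _ (l d1) d2)) _)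
      (pow_mem_degLE (Submodule.sub_mem _ (l d0) d2) _))
      (pow_mem_degLE d1 _))
      (pow_mem_degLE d0 _)) (pow_mem_degLE (Submodule.add_mem _ (l d1) d2) _))
      (pow_mem_degLE d2 _))
  push_cast; ring

theorem isOrdered : IsOrdered (P.φ 0 1 2) := by
  have h2 : ∀ i : Fin 3, i ≠ 2 → Trunc (e 2 - e i) (P.φ 0 1 2) := by
    intro i hi n
    filter_upwards [eventually_ge_atTop (P.M 2 - n 2).toNat] with m hm
    refine P.trunc_inner 0 1 2 (by decide) (by decide) (by decide) _ ?_
    simp [e_ne hi.symm]; lia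
  intro i j hij
  obtain ⟨rfl, rfl⟩ | ⟨hi, rfl⟩ : (i = 0 ∧ j = 1) ∨ (i ≠ 2 ∧ j = 2) := by
    revert hij; revert i j; decide
  · exact P.trunc_outer 0 1 2 (by decide) (by decide) (by decide)
  · exact h2 i hi

theorem φ_mono_eq_zero_of_cleared {C : ℕ}
    (hbase : ∀ a b c, C ≤ a + b + c → P.cleared (pairDMono a b c (mono (-1))) = 0)
    {n : Fin 3 → ℤ} (hn : n 0 + n 1 + n 2 ≤ -3 - C + P.total) : P.φ 0 1 2 (mono n) = 0 :=
  P.cancel_denom _ P.isOrdered (-3 - C)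
    (fun _ hm => apply_mono_eq_zero_of_sum_le hbase P.cleared_mono_eq_zero hm) n hn

/-- The three bounds for the operators ∂_i + ∂_j add up to twice the total pole order, so among 2 ·
total + 1 such derivatives one bound is exceeded. -/
theorem φ_mono_eq_zero {n : Fin 3 → ℤ} (hn : n 0 + n 1 + n 2 < -3 - P.total) :
    P.φ 0 1 2 (mono n) = 0 := by
  refine P.φ_mono_eq_zero_of_cleared (C := 2 * P.total + 1) (fun a b c habc => ?_) (by push_cast; lia)
  refine apply_pairDMono_eq_zero P.cleared_pairD_01 P.cleared_pairD_02 P.cleared_pairD_12 ?_ _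
  simp only [total] at habc
  lia

/-- This gains one degree. The hypothesis `htop` says that the leading pole at z_2 = 0 leaves no
pole in z_1. The numerator then vanishes at z_1 = z_2 = 0 because of the factor z_1 - z_2, so it has
no pure power of z_0 and the critical derivative is zero. -/
theorem φ_mono_eq_zero_of_top (hN : 0 < P.N 1 2)
    (htop : ∀ n : Fin 3 → ℤ, n 2 = P.M 2 - 1 → 0 ≤ n 1 → P.φ 0 1 2 (mono n) = 0)
    {n : Fin 3 → ℤ} (hn : n 0 + n 1 + n 2 ≤ -3 - P.total) :
    P.φ 0 1 2 (mono n) = 0 := by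
  have h0 : ∀ C : ℤ, P.cleared (mono (-1 - C • e 0)) = 0 := by
    intro C
    obtain ⟨N, hN'⟩ := Nat.exists_eq_add_of_le' hN
    have hp := (((((isPoly_z_sub_z 0 1).pow (P.N 0 1)).mul ((isPoly_z_sub_z 0 2).pow (P.N 0 2))).mul
      ((isPoly_z_sub_z 1 2).pow N)).mul ((isPoly_z 0).pow (P.M 0))).mul ((isPoly_z 1).pow (P.M 1))
    -- The set is closed under raising exponents. One factor z_1 - z_2 has been split off: its z_1
    -- term reaches the second alternative, its z_2 term the first.
    have hS := hp {n | (P.M 2 : ℤ) ≤ n 2 ∨ (n 2 = P.M 2 - 1 ∧ 0 ≤ n 1)} (by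
      intro n hn i
      obtain rfl | rfl | rfl : i = 0 ∨ i = 1 ∨ i = 2 := by fin_cases i <;> simp
      · simpa [e] using hn
      · simp [e] at hn ⊢; lia
      · simp [e] at hn ⊢; lia) (P.φ 0 1 2) (by
      rintro n (hn | hn)
      · exact P.trunc_inner 0 1 2 (by decide) (by decide) (by decide) n hn
      · exact htop n hn.1 hn.2)
    have h1 := hS (-1 - C • e 0 + (P.M 2 : ℤ) • e 2 + e 1) (Or.inr (by
      constructor
      · simp [e]; ring
      · simp [e]))
    have h2 := hS (-1 - C • e 0 + (P.M 2 : ℤ) • e 2 + e 2) (Or.inl (by simp [e]))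
    rw [← z_mul_mono, ← z_pow_mul_mono] at h1 h2
    have h3 := congrArg₂ (· - ·) h1 h2
    simp only [← map_sub, sub_zero] at h3
    rw [cleared, act_apply, denom, hN', ← h3]
    congr 1
    ring
  refine P.φ_mono_eq_zero_of_cleared (C := 2 * P.total) (fun a b c habc => ?_) (by push_cast; lia)
  rcases em (a = P.N 0 2 + P.N 1 2 + P.M 0 + P.M 1 ∧ b = P.N 0 1 + P.N 1 2 + P.M 0 + P.M 2 ∧
    c = P.N 0 1 + P.N 0 2 + P.M 1 + P.M 2) with ⟨rfl, rfl, rfl⟩ | hne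
  · exact apply_pairDMono_critical P.cleared_pairD_01 P.cleared_pairD_02 P.cleared_pairD_12 (h0 _)
  · refine apply_pairDMono_eq_zero P.cleared_pairD_01 P.cleared_pairD_02 P.cleared_pairD_12 ?_ _
    simp only [total] at habc
    lia

end Correlator

end Laurent

/-! ### Associativity and modes on V ⊗ V -/

open Filter in
theorem eventually_finsum_eq_sum_range {W : Type*} [AddCommGroup W] {f : ℕ → W}
    (h : ∀ᶠ j in atTop, f j = 0) :
    ∀ᶠ B in atTop, ∑ᶠ j, f j = ∑ j ∈ Finset.range B, f j := by
  obtain ⟨B₀, hB₀⟩ := eventually_atTop.1 h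
  filter_upwards [eventually_ge_atTop B₀] with B hB
  refine finsum_eq_sum_of_support_subset _ fun j hj => ?_
  simp only [Finset.coe_range, Set.mem_Iio]
  by_contra! hc
  exact hj (hB₀ j (hB.trans hc))

theorem finsum_extend_zero {ι κ W : Type*} [AddCommGroup W] {g : ι → κ} (hg : g.Injective)
    (f : ι → W) : ∑ᶠ k, Function.extend g f 0 k = ∑ᶠ i, f i := by
  have h1 : ∑ᶠ k ∈ Set.range g, Function.extend g f 0 k = ∑ᶠ i, Function.extend g f 0 (g i) :=
    finsum_mem_range hg
  simp only [hg.extend_apply] at h1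
  rw [← h1]
  refine finsum_congr fun k => ?_
  by_cases hk : k ∈ Set.range g
  · simp [hk]
  · rw [Function.extend_apply' _ _ _ hk]
    simp

namespace VertexAlgebra

open Filter

variable {V : Type*} [AddCommGroup V] [Module ℂ V] (A : VertexAlgebra V)

/-- The coefficients `(-1) ^ j * choose r j` in the expansion of `(z - w) ^ r`. -/
def coef (r : ℤ) (j : ℕ) : ℤ := (-1 : ℤ) ^ j * Ring.choose r j

theorem iterate_eq_finsum (a b c : V) (q r : ℤ) :
    A.prod q (A.prod r a b) c = ∑ᶠ j : ℕ, coef r j •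
      (A.prod (r - j) a (A.prod (q + j) b c) -
        (r.negOnePow : ℤ) • A.prod (q + r - j) b (A.prod j a c)) := by
  have h := A.borcherds a b c 0 q r
  rw [finsum_eq_single _ 0] at h
  · simpa [coef] using h
  · intro i hi
    rw [Ring.choose_zero_pos ℤ (Nat.pos_of_ne_zero hi), zero_smul]

theorem eventually_prod_add_eq_zero (a b : V) (n : ℤ) :
    ∀ᶠ j : ℕ in atTop, A.prod (n + j) a b = 0 := by
  obtain ⟨N, hN⟩ := A.truncation a b
  filter_upwards [eventually_ge_atTop (N - n).toNat] with j hj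
  exact hN _ (by lia)

theorem eventually_iterate (a b c : V) (q r : ℤ) :
    ∀ᶠ B : ℕ in atTop, A.prod q (A.prod r a b) c = ∑ j ∈ Finset.range B, coef r j •
      (A.prod (r - j) a (A.prod (q + j) b c) -
        (r.negOnePow : ℤ) • A.prod (q + r - j) b (A.prod j a c)) := by
  rw [iterate_eq_finsum]
  refine eventually_finsum_eq_sum_range ?_
  filter_upwards [A.eventually_prod_add_eq_zero b c q, A.eventually_prod_add_eq_zero a c 0]
    with j h1 h2
  rw [zero_add] at h2
  simp [h1, h2]

/-- Only the mode -1 of the vacuum is nonzero, so each half of the associativity formula keeps at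
most one term. Writing it with `Function.extend` lets sums over i ∈ ℤ be reindexed by j ∈ ℕ. -/
theorem prod_prod_vac (a c : V) (i r : ℤ) :
    A.prod i (A.prod r a A.vac) c =
      Function.extend (fun j : ℕ => -1 - (j : ℤ)) (fun j => coef r j • A.prod (r - j) a c) 0 i -
      Function.extend (fun j : ℕ => (j : ℤ) - r - 1)
        (fun j => coef r j • (r.negOnePow : ℤ) • A.prod j a c) 0 i := by
  have i1 : Function.Injective (fun j : ℕ => -1 - (j : ℤ)) := fun x y h => by simpa using h
  have i2 : Function.Injective (fun j : ℕ => (j : ℤ) - r - 1) := fun x y h => by simpa using h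
  obtain ⟨B, hB, hi, hr⟩ := ((A.eventually_iterate a A.vac c i r).and
    ((eventually_ge_atTop (-i).toNat).and (eventually_ge_atTop (i + r + 2).toNat))).exists
  rw [hB]
  simp only [smul_sub, Finset.sum_sub_distrib, A.vac_prod]
  congr 1
  · by_cases h : 0 ≤ -1 - i
    · obtain ⟨k, hk⟩ := Int.eq_ofNat_of_zero_le h
      obtain rfl : i = -1 - (k : ℤ) := by lia
      rw [i1.extend_apply, Finset.sum_eq_single k]
      · simp
      · intro b _ hb
        rw [if_neg (by lia), map_zero, smul_zero]
      · intro hk'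
        exact absurd (Finset.mem_range.2 (by lia)) hk'
    · rw [Function.extend_apply' _ _ _ (by rintro ⟨j, hj⟩; lia)]
      refine Finset.sum_eq_zero fun j _ => ?_
      rw [if_neg (by lia), map_zero, smul_zero]
  · by_cases h : 0 ≤ i + r + 1
    · obtain ⟨k, hk⟩ := Int.eq_ofNat_of_zero_le h
      obtain rfl : i = (k : ℤ) - r - 1 := by lia
      rw [i2.extend_apply, Finset.sum_eq_single k]
      · rw [if_pos (by lia)]
      · intro b _ hb
        rw [if_neg (by lia), smul_zero, smul_zero]
      · intro hk'
        exact absurd (Finset.mem_range.2 (by lia)) hk'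
    · rw [Function.extend_apply' _ _ _ (by rintro ⟨j, hj⟩; lia)]
      refine Finset.sum_eq_zero fun j _ => ?_
      rw [if_neg (by lia), smul_zero, smul_zero]

/-- The products of `V ⊗ V` as bilinear maps. -/
noncomputable def tensorProdₗ (n : ℤ) : (V ⊗[ℂ] V) →ₗ[ℂ] (V ⊗[ℂ] V) →ₗ[ℂ] (V ⊗[ℂ] V) :=
  LinearMap.mk₂ ℂ (A.tensorProd n)
    (fun u u' v => by
      simp only [tensorProd, map_add, LinearMap.add_apply]
      exact finsum_add_distrib (A.finite_support_tensorTerm n u v)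
        (A.finite_support_tensorTerm n u' v))
    (fun c u v => by
      simp only [tensorProd, map_smul, LinearMap.smul_apply]
      exact (smul_finsum' c (A.finite_support_tensorTerm n u v)).symm)
    (fun u v v' => by
      simp only [tensorProd, map_add]
      exact finsum_add_distrib (A.finite_support_tensorTerm n u v)
        (A.finite_support_tensorTerm n u v'))
    (fun c u v => by
      simp only [tensorProd, map_smul]
      exact (smul_finsum' c (A.finite_support_tensorTerm n u v)).symm)

theorem tensorProdₗ_apply (n : ℤ) (u v : V ⊗[ℂ] V) :
    A.tensorProdₗ n u v = A.tensorProd n u v := rfl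

theorem tensorTerm_tmul (n i : ℤ) (a b c d : V) :
    A.tensorTerm n i (a ⊗ₜ b) (c ⊗ₜ d) = A.prod i a c ⊗ₜ A.prod (n - 1 - i) b d := by
  simp [tensorTerm]

theorem tensorProd_tmul_vac (n : ℤ) (a c d : V) :
    A.tensorProd n (a ⊗ₜ A.vac) (c ⊗ₜ d) = A.prod n a c ⊗ₜ d := by
  rw [tensorProd, finsum_eq_single _ n]
  · rw [tensorTerm_tmul, vac_prod, if_pos (by lia)]
  · intro i hi
    rw [tensorTerm_tmul, vac_prod, if_neg (by lia), TensorProduct.tmul_zero]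

theorem comm_tensorProd (n : ℤ) (u v : V ⊗[ℂ] V) :
    TensorProduct.comm ℂ V V (A.tensorProd n u v) =
      A.tensorProd n (TensorProduct.comm ℂ V V u) (TensorProduct.comm ℂ V V v) := by
  have h := (TensorProduct.comm ℂ V V).toLinearMap.toAddMonoidHom.map_finsum
    (A.finite_support_tensorTerm n u v)
  refine h.trans ?_
  rw [tensorProd, ← finsum_comp_equiv (Equiv.subLeft (n - 1))]
  refine finsum_congr fun i => ?_
  refine (A.comm_tensorTerm n _ u v).trans ?_
  simp

theorem tensorProd_vac_tmul (n : ℤ) (a c d : V) :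
    A.tensorProd n (A.vac ⊗ₜ a) (c ⊗ₜ d) = c ⊗ₜ A.prod n a d := by
  have h := A.comm_tensorProd n (a ⊗ₜ A.vac) (d ⊗ₜ c)
  simpa [tensorProd_tmul_vac] using h.symm

/-- The associativity formula with a and b acting on different tensor factors; it supplies the cross
terms for odd vectors. -/
theorem eventually_tensorProd_tmul (n r : ℤ) (a b c d : V) :
    ∀ᶠ B : ℕ in atTop, A.tensorProd n (A.prod r a A.vac ⊗ₜ b) (c ⊗ₜ d) =
      ∑ j ∈ Finset.range B, coef r j • (A.prod (r - j) a c ⊗ₜ[ℂ] A.prod (n + j) b d -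
        (r.negOnePow : ℤ) • (A.prod j a c ⊗ₜ[ℂ] A.prod (n + r - j) b d)) := by
  have i1 : Function.Injective (fun j : ℕ => -1 - (j : ℤ)) := fun x y h => by simpa using h
  have i2 : Function.Injective (fun j : ℕ => (j : ℤ) - r - 1) := fun x y h => by simpa using h
  set f₁ : ℕ → V ⊗[ℂ] V := fun j => coef r j • (A.prod (r - j) a c ⊗ₜ[ℂ] A.prod (n + j) b d)
  set f₂ : ℕ → V ⊗[ℂ] V := fun j => coef r j • (r.negOnePow : ℤ) •
    (A.prod j a c ⊗ₜ[ℂ] A.prod (n + r - j) b d)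
  have h1 : ∀ᶠ j in atTop, f₁ j = 0 := by
    filter_upwards [A.eventually_prod_add_eq_zero b d n] with j hj
    simp [f₁, hj]
  have h2 : ∀ᶠ j in atTop, f₂ j = 0 := by
    filter_upwards [A.eventually_prod_add_eq_zero a c 0] with j hj
    rw [zero_add] at hj
    simp [f₂, hj]
  have key : A.tensorProd n (A.prod r a A.vac ⊗ₜ b) (c ⊗ₜ d) = ∑ᶠ j, f₁ j - ∑ᶠ j, f₂ j := by
    have fin : ∀ {f : ℕ → V ⊗[ℂ] V} {g : ℕ → ℤ}, g.Injective → (∀ᶠ j in atTop, f j = 0) →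
        (Function.support (Function.extend g f 0)).Finite := by
      intro f g hg hf
      obtain ⟨B, hB⟩ := eventually_atTop.1 hf
      refine ((Finset.range B).finite_toSet.image g).subset fun i hi => ?_
      by_cases hx : ∃ j, g j = i
      · obtain ⟨j, rfl⟩ := hx
        refine ⟨j, ?_, rfl⟩
        simp only [Finset.coe_range, Set.mem_Iio]
        by_contra! hc
        rw [Function.mem_support, hg.extend_apply] at hi
        exact hi (hB _ hc)
      · rw [Function.mem_support, Function.extend_apply' _ _ _ hx] at hi
        exact absurd rfl hi
    rw [← finsum_extend_zero i1, ← finsum_extend_zero i2,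
      ← finsum_sub_distrib (fin i1 h1) (fin i2 h2), tensorProd]
    refine finsum_congr fun i => ?_
    rw [tensorTerm_tmul, prod_prod_vac, TensorProduct.sub_tmul]
    congr 1
    · by_cases hx : ∃ j : ℕ, -1 - (j : ℤ) = i
      · obtain ⟨j, rfl⟩ := hx
        have hj : n - 1 - (-1 - (j : ℤ)) = n + j := by ring
        rw [i1.extend_apply, i1.extend_apply, ← TensorProduct.smul_tmul', hj]
      · rw [Function.extend_apply' _ _ _ hx, Function.extend_apply' _ _ _ hx]
        simp
    · by_cases hx : ∃ j : ℕ, (j : ℤ) - r - 1 = i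
      · obtain ⟨j, rfl⟩ := hx
        have hj : n - 1 - ((j : ℤ) - r - 1) = n + r - j := by ring
        rw [i2.extend_apply, i2.extend_apply, ← TensorProduct.smul_tmul',
          ← TensorProduct.smul_tmul', hj]
      · rw [Function.extend_apply' _ _ _ hx, Function.extend_apply' _ _ _ hx]
        simp
  filter_upwards [eventually_finsum_eq_sum_range h1, eventually_finsum_eq_sum_range h2]
    with B hB1 hB2
  rw [key, hB1, hB2, ← Finset.sum_sub_distrib]
  exact Finset.sum_congr rfl fun j _ => (smul_sub _ _ _).symm

/-! ### Odd vectors: associativity and locality -/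

/-- The modes of the anti-invariant vector `a ⊗ 𝟏 - 𝟏 ⊗ a`. -/
noncomputable def oddMode (n : ℤ) (a : V) : V ⊗[ℂ] V →ₗ[ℂ] V ⊗[ℂ] V :=
  (A.prod n a).rTensor V - (A.prod n a).lTensor V

/-- The anti-invariant vector `a ⊗ 𝟏 - 𝟏 ⊗ a`. -/
def oddVec (a : V) : V ⊗[ℂ] V := a ⊗ₜ A.vac - A.vac ⊗ₜ a

theorem oddMode_tmul (n : ℤ) (a c d : V) :
    A.oddMode n a (c ⊗ₜ d) = A.prod n a c ⊗ₜ d - c ⊗ₜ A.prod n a d := by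
  simp [oddMode]

theorem oddMode_oddVec (n : ℤ) (a b : V) : A.oddMode n a (A.oddVec b) =
    (A.prod n a b ⊗ₜ A.vac + A.vac ⊗ₜ A.prod n a b) -
      (A.prod n a A.vac ⊗ₜ b + b ⊗ₜ A.prod n a A.vac) := by
  simp only [oddVec, map_sub, oddMode_tmul]
  abel

theorem oddMode_oddVec_mem (n : ℤ) (a b : V) : A.oddMode n a (A.oddVec b) ∈ A.orbifold := by
  change TensorProduct.comm ℂ V V (A.oddMode n a (A.oddVec b)) = A.oddMode n a (A.oddVec b)
  rw [oddMode_oddVec]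
  simp only [map_sub, map_add, TensorProduct.comm_tmul]
  abel

theorem eventually_oddMode_add_eq_zero (a : V) (v : V ⊗[ℂ] V) (n : ℤ) :
    ∀ᶠ j : ℕ in atTop, A.oddMode (n + j) a v = 0 := by
  induction v using TensorProduct.induction_on with
  | zero => simp
  | tmul c d =>
    filter_upwards [A.eventually_prod_add_eq_zero a c n, A.eventually_prod_add_eq_zero a d n]
      with j h1 h2
    simp [oddMode_tmul, h1, h2]
  | add u v hu hv =>
    filter_upwards [hu, hv] with j h1 h2
    rw [map_add, h1, h2, add_zero]

theorem oddMode_oddVec_eq_zero {n : ℤ} (hn : 0 ≤ n) {a b : V} (h : A.prod n a b = 0) :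
    A.oddMode n a (A.oddVec b) = 0 := by
  simp [oddMode_oddVec, h, A.prod_vac_of_nonneg n a hn]

theorem eventually_oddMode_iterate (a b : V) (n r : ℤ) (v : V ⊗[ℂ] V) :
    ∀ᶠ B : ℕ in atTop, A.tensorProd n (A.oddMode r a (A.oddVec b)) v =
      ∑ j ∈ Finset.range B, coef r j • (A.oddMode (r - j) a (A.oddMode (n + j) b v) -
        (r.negOnePow : ℤ) • A.oddMode (n + r - j) b (A.oddMode j a v)) := by
  induction v using TensorProduct.induction_on with
  | zero => simp [← tensorProdₗ_apply]
  | add u v hu hv =>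
    filter_upwards [hu, hv] with B h1 h2
    rw [← tensorProdₗ_apply, map_add, tensorProdₗ_apply, tensorProdₗ_apply, h1, h2,
      ← Finset.sum_add_distrib]
    refine Finset.sum_congr rfl fun j _ => ?_
    simp only [map_add]
    module
  | tmul c d =>
    filter_upwards [A.eventually_iterate a b c n r, A.eventually_iterate a b d n r,
      A.eventually_tensorProd_tmul n r a b c d, A.eventually_tensorProd_tmul n r a b d c]
      with B h1 h2 h3 h4
    have h4' := congrArg (TensorProduct.comm ℂ V V) h4
    rw [comm_tensorProd, map_sum] at h4'
    simp only [TensorProduct.comm_tmul, map_zsmul, map_sub] at h4'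
    rw [oddMode_oddVec, ← tensorProdₗ_apply]
    simp only [map_sub, map_add, LinearMap.sub_apply, LinearMap.add_apply, tensorProdₗ_apply]
    rw [tensorProd_tmul_vac, tensorProd_vac_tmul, h3, h4', h1, h2, TensorProduct.sum_tmul,
      TensorProduct.tmul_sum, ← Finset.sum_add_distrib, ← Finset.sum_add_distrib,
      ← Finset.sum_sub_distrib]
    refine Finset.sum_congr rfl fun j _ => ?_
    simp only [oddMode_tmul, map_sub, TensorProduct.sub_tmul, TensorProduct.tmul_sub,
      ← TensorProduct.smul_tmul', TensorProduct.tmul_smul]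
    module

/-- The Borcherds identity with r = N: all products a_(N+i) b vanish, so its left side is zero. -/
theorem prod_locality {a b : V} {N : ℕ} (h : ∀ n : ℤ, N ≤ n → A.prod n a b = 0) (m n : ℤ) (c : V) :
    ∑ j ∈ Finset.range (N + 1), coef N j • (A.prod (m + N - j) a (A.prod (n + j) b c) -
      A.prod (n + j) b (A.prod (m + N - j) a c)) = 0 := by
  have hb := A.borcherds a b c m n N
  have hl : (∑ᶠ i : ℕ, Ring.choose m i • A.prod (m + n - i) (A.prod (N + i) a b) c) = 0 := by
    rw [← finsum_zero (α := ℕ)]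
    refine finsum_congr fun i => ?_
    rw [h _ (by lia)]
    simp
  rw [hl, finsum_eq_sum_of_support_subset (s := Finset.range (N + 1))] at hb
  · simp only [smul_sub, Finset.sum_sub_distrib] at hb ⊢
    rw [hb]
    congr 1
    -- Reversing j ↦ N - j in the second half absorbs the sign (-1)^N.
    rw [← Finset.sum_range_reflect]
    refine Finset.sum_congr rfl fun j hj => ?_
    have hj' : j ≤ N := by simpa [Nat.lt_succ_iff] using hj
    have e1 : N + 1 - 1 - j = N - j := by lia
    rw [e1, smul_smul]
    have e2 : n + ((N - j : ℕ) : ℤ) = n + N - j := by lia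
    have e3 : m + N - ((N - j : ℕ) : ℤ) = m + j := by lia
    rw [e2, e3]
    congr 1
    simp only [coef, Ring.choose_natCast, Nat.choose_symm hj']
    have h1 : ((N : ℤ).negOnePow : ℤ) = (-1) ^ N := by
      rw [Int.negOnePow_def, zpow_natCast]; simp
    have h2 : (-1 : ℤ) ^ N = (-1) ^ j * (-1) ^ (N - j) := by
      rw [← pow_add]; congr 1; lia
    have h3 : (-1 : ℤ) ^ j * (-1) ^ j = 1 := by rw [← mul_pow]; simp
    rw [h1, h2]
    linear_combination (-(-1 : ℤ) ^ (N - j) * ((N.choose j : ℕ) : ℤ)) * h3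
  · intro j hj
    simp only [Finset.coe_range, Set.mem_Iio]
    by_contra! hc
    apply hj
    dsimp only
    rw [Ring.choose_natCast, Nat.choose_eq_zero_of_lt (by lia)]
    simp

theorem oddMode_locality {a b : V} {N : ℕ} (h : ∀ n : ℤ, N ≤ n → A.prod n a b = 0) (m n : ℤ)
    (v : V ⊗[ℂ] V) :
    ∑ j ∈ Finset.range (N + 1), coef N j • (A.oddMode (m + N - j) a (A.oddMode (n + j) b v) -
      A.oddMode (n + j) b (A.oddMode (m + N - j) a v)) = 0 := by
  induction v using TensorProduct.induction_on with
  | zero => simp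
  | add u v hu hv =>
    rw [← add_zero (0 : V ⊗[ℂ] V)]
    nth_rw 1 [← hu]
    rw [← hv, ← Finset.sum_add_distrib]
    refine Finset.sum_congr rfl fun j _ => ?_
    simp only [map_add]
    module
  | tmul c d =>
    have h1 := congrArg (fun x => x ⊗ₜ[ℂ] d) (A.prod_locality h m n c)
    have h2 := congrArg (fun x => c ⊗ₜ[ℂ] x) (A.prod_locality h m n d)
    simp only [TensorProduct.sum_tmul, TensorProduct.tmul_sum, TensorProduct.zero_tmul,
      TensorProduct.tmul_zero] at h1 h2
    rw [← add_zero (0 : V ⊗[ℂ] V)]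
    nth_rw 1 [← h1]
    rw [← h2, ← Finset.sum_add_distrib]
    refine Finset.sum_congr rfl fun j _ => ?_
    simp only [oddMode_tmul, map_sub, TensorProduct.sub_tmul, TensorProduct.tmul_sub,
      ← TensorProduct.smul_tmul', TensorProduct.tmul_smul]
    module

end VertexAlgebra

/-! ### Translation, C₂(T) and functionals on R(T) -/

namespace Laurent

open Filter

theorem z_sub_z_pow_mul_mono (i j : Fin 3) (N : ℕ) (n : Fin 3 → ℤ) :
    (z i - z j) ^ N * mono n = ∑ m ∈ Finset.range (N + 1),
      (VertexAlgebra.coef N m : ℂ) • mono (n + ((N : ℤ) - m) • e i + (m : ℤ) • e j) := by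
  rw [sub_eq_neg_add, add_pow, Finset.sum_mul]
  refine Finset.sum_congr rfl fun m hm => ?_
  have hm' : m ≤ N := by simpa [Nat.lt_succ_iff] using hm
  have h1 : n + ((N : ℤ) - m) • e i + (m : ℤ) • e j =
      n + ((N - m : ℕ) : ℤ) • e i + (m : ℤ) • e j := by
    rw [Nat.cast_sub hm']
  rw [h1, ← z_pow_mul_mono, ← z_pow_mul_mono, VertexAlgebra.coef, Ring.choose_natCast,
    Algebra.smul_def, neg_pow]
  push_cast
  ring

end Laurent

namespace VertexAlgebra

open Filter

variable {V : Type*} [AddCommGroup V] [Module ℂ V] (A : VertexAlgebra V)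

theorem coef_neg_two (j : ℕ) : coef (-2) j = j + 1 := by
  induction j with
  | zero => simp [coef]
  | succ j ih =>
    have h := Laurent.succ_mul_choose_succ (-2) j
    rw [coef] at ih ⊢
    have h0 : ((j : ℤ) + 1) ≠ 0 := by lia
    refine mul_left_cancel₀ h0 ?_
    rw [pow_succ]
    push_cast
    linear_combination (-(-1 : ℤ) ^ j) * h + (j + 2) * ih

theorem prod_translation (i : ℤ) (a c : V) :
    A.prod i (A.prod (-2) a A.vac) c = (-i : ℤ) • A.prod (i - 1) a c := by
  have i1 : Function.Injective (fun j : ℕ => -1 - (j : ℤ)) := fun x y h => by simpa using h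
  have i2 : Function.Injective (fun j : ℕ => (j : ℤ) - (-2) - 1) := fun x y h => by simpa using h
  rw [prod_prod_vac]
  rcases lt_trichotomy i 0 with hi | rfl | hi
  · obtain ⟨k, hk⟩ := Int.eq_ofNat_of_zero_le (show 0 ≤ -1 - i by lia)
    obtain rfl : i = -1 - (k : ℤ) := by lia
    rw [i1.extend_apply, Function.extend_apply' _ _ _ (by rintro ⟨j, hj⟩; lia), coef_neg_two]
    have h1 : -1 - (k : ℤ) - 1 = -2 - k := by ring
    have h2 : -(-1 - (k : ℤ)) = k + 1 := by ring
    simp [h1, h2]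
  · rw [Function.extend_apply' _ _ _ (by rintro ⟨j, hj⟩; lia),
      Function.extend_apply' _ _ _ (by rintro ⟨j, hj⟩; lia)]
    simp
  · obtain ⟨k, hk⟩ := Int.eq_ofNat_of_zero_le (show 0 ≤ i - 1 by lia)
    obtain rfl : i = (k : ℤ) - (-2) - 1 := by lia
    rw [i2.extend_apply, Function.extend_apply' _ _ _ (by rintro ⟨j, hj⟩; lia), coef_neg_two]
    have h1 : (k : ℤ) - (-2) - 1 - 1 = k := by ring
    have h2 : -((k : ℤ) - (-2) - 1) = -(k + 1) := by ring
    have h3 : ((-2 : ℤ).negOnePow : ℤ) = 1 := by decide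
    rw [h1, h2, h3, one_smul, neg_smul]
    simp

/-- The translation operator of `V ⊗ V`. -/
noncomputable def tensorTranslation : V ⊗[ℂ] V →ₗ[ℂ] V ⊗[ℂ] V :=
  ((A.prod (-2)).flip A.vac).rTensor V + ((A.prod (-2)).flip A.vac).lTensor V

theorem tensorTranslation_tmul (a b : V) : A.tensorTranslation (a ⊗ₜ b) =
    A.prod (-2) a A.vac ⊗ₜ b + a ⊗ₜ A.prod (-2) b A.vac := by
  simp [tensorTranslation]

theorem tensorTranslation_mem {u : V ⊗[ℂ] V} (hu : u ∈ A.orbifold) :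
    A.tensorTranslation u ∈ A.orbifold := by
  have h : ∀ u : V ⊗[ℂ] V, TensorProduct.comm ℂ V V (A.tensorTranslation u) =
      A.tensorTranslation (TensorProduct.comm ℂ V V u) := by
    intro u
    induction u using TensorProduct.induction_on with
    | zero => simp
    | tmul a b =>
      simp only [tensorTranslation_tmul, TensorProduct.comm_tmul, map_add]
      abel
    | add u v hu hv => simp only [map_add, hu, hv]
  have hu' : TensorProduct.comm ℂ V V u = u := hu
  change TensorProduct.comm ℂ V V (A.tensorTranslation u) = A.tensorTranslation u
  rw [h, hu']

theorem tensorProd_translation (n : ℤ) (u v : V ⊗[ℂ] V) :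
    A.tensorProd n (A.tensorTranslation u) v = (-n : ℤ) • A.tensorProd (n - 1) u v := by
  simp only [← tensorProdₗ_apply]
  induction u using TensorProduct.induction_on with
  | zero => simp
  | add u u' hu hu' => simp only [map_add, LinearMap.add_apply, hu, hu', smul_add]
  | tmul a b =>
    induction v using TensorProduct.induction_on with
    | zero => simp
    | add v v' hv hv' => simp only [map_add, hv, hv', smul_add]
    | tmul c d =>
      have f1 := A.finite_support_tensorTerm n (A.prod (-2) a A.vac ⊗ₜ b) (c ⊗ₜ d)
      have f2 := A.finite_support_tensorTerm n (a ⊗ₜ A.prod (-2) b A.vac) (c ⊗ₜ d)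
      rw [tensorTranslation_tmul, map_add, LinearMap.add_apply]
      simp only [tensorProdₗ_apply, tensorProd]
      rw [← finsum_comp_equiv (Equiv.addRight (1 : ℤ)), ← finsum_add_distrib _ f2,
        smul_finsum' _ (A.finite_support_tensorTerm _ _ _)]
      · refine finsum_congr fun i => ?_
        simp only [tensorTerm_tmul, prod_translation, Equiv.coe_addRight]
        have e1 : i + 1 - 1 = i := by ring
        have e2 : n - 1 - (i + 1) = n - 1 - 1 - i := by ring
        have e3 : n - 1 - i - 1 = n - 1 - 1 - i := by ring
        rw [e1, e2, e3, ← TensorProduct.smul_tmul', TensorProduct.tmul_smul, ← add_smul]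
        congr 1
        ring
      · exact f1.preimage (Equiv.addRight (1 : ℤ)).injective.injOn

/-- The translation operator preserves T and satisfies (∂u)_(n) v = -n u_(n-1) v, so the index can
be lowered from -2 without bound. -/
theorem orbifoldProd_mem_orbifoldC2 {n : ℤ} (hn : n ≤ -2) (u v : A.orbifold) :
    A.orbifoldProd n u v ∈ A.orbifoldC2 := by
  obtain ⟨k, rfl⟩ : ∃ k : ℕ, n = -2 - k := ⟨(-2 - n).toNat, by lia⟩
  clear hn
  induction k generalizing u with
  | zero => exact Submodule.subset_span ⟨u, v, by simp⟩
  | succ k ih =>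
    have h := ih ⟨_, A.tensorTranslation_mem u.2⟩
    have h2 : A.orbifoldProd (-2 - k) ⟨_, A.tensorTranslation_mem u.2⟩ v =
        ((k : ℂ) + 2) • A.orbifoldProd (-2 - ((k + 1 : ℕ) : ℤ)) u v := by
      refine Subtype.ext ?_
      change A.tensorProd _ _ _ = ((k : ℂ) + 2) • A.tensorProd _ _ _
      rw [tensorProd_translation, ← Int.cast_smul_eq_zsmul ℂ]
      have e1 : (-2 : ℤ) - k - 1 = -2 - ((k + 1 : ℕ) : ℤ) := by push_cast; ring
      rw [e1]
      congr 1
      push_cast; ring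
    rw [h2] at h
    have h0 : (k : ℂ) + 2 ≠ 0 := by exact_mod_cast (by lia : k + 2 ≠ 0)
    exact (Submodule.smul_mem_iff _ h0).1 h

/-- Symmetrization `V ⊗ V → (V ⊗ V)^{S₂}`. -/
noncomputable def symmetrize : V ⊗[ℂ] V →ₗ[ℂ] A.orbifold :=
  LinearMap.codRestrict A.orbifold (LinearMap.id + (TensorProduct.comm ℂ V V).toLinearMap)
    (fun u => by
      change TensorProduct.comm ℂ V V (u + TensorProduct.comm ℂ V V u) =
        u + TensorProduct.comm ℂ V V u
      rw [map_add, add_comm]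
      congr 1
      exact TensorProduct.comm_comm ℂ V V u)

theorem symmetrize_of_mem {u : V ⊗[ℂ] V} (hu : u ∈ A.orbifold) :
    A.symmetrize u = (2 : ℂ) • ⟨u, hu⟩ := by
  refine Subtype.ext ?_
  have hu' : TensorProduct.comm ℂ V V u = u := hu
  change u + TensorProduct.comm ℂ V V u = (2 : ℂ) • u
  rw [hu', two_smul]

/-- The functional on `V ⊗ V` induced by a functional on `R((V ⊗ V)^{S₂})`. -/
noncomputable def pullback (f : A.OrbifoldR →ₗ[ℂ] ℂ) : V ⊗[ℂ] V →ₗ[ℂ] ℂ :=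
  f ∘ₗ A.orbifoldC2.mkQ ∘ₗ A.symmetrize

theorem pullback_tensorProd (f : A.OrbifoldR →ₗ[ℂ] ℂ) {n : ℤ} (hn : n ≤ -2) {u v : V ⊗[ℂ] V}
    (hu : u ∈ A.orbifold) (hv : v ∈ A.orbifold) : A.pullback f (A.tensorProd n u v) = 0 := by
  have h := A.orbifoldProd_mem_orbifoldC2 hn ⟨u, hu⟩ ⟨v, hv⟩
  rw [pullback, LinearMap.comp_apply, LinearMap.comp_apply,
    A.symmetrize_of_mem (A.tensorProd_mem_orbifold n hu hv)]
  have h2 : A.orbifoldC2.mkQ (A.orbifoldProd n ⟨u, hu⟩ ⟨v, hv⟩) = 0 := by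
    simpa using h
  rw [orbifoldProd] at h2
  rw [map_smul, h2]
  simp

theorem pullback_eta (f : A.OrbifoldR →ₗ[ℂ] ℂ) (a : V) :
    A.pullback f (a ⊗ₜ A.vac + A.vac ⊗ₜ a) = 2 * f (A.etaBar a) := by
  have h : A.symmetrize (a ⊗ₜ A.vac + A.vac ⊗ₜ a) = (2 : ℂ) • A.eta a :=
    A.symmetrize_of_mem (A.eta a).2
  rw [pullback, LinearMap.comp_apply, LinearMap.comp_apply, h, map_smul, map_smul, etaBar]
  rfl

theorem tensorProd_eta_eta (n : ℤ) (a b : V) : A.tensorProd n (A.eta a) (A.eta b) =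
    (A.prod n a b ⊗ₜ A.vac + A.vac ⊗ₜ A.prod n a b) +
      (A.prod n a A.vac ⊗ₜ b + b ⊗ₜ A.prod n a A.vac) := by
  have h : ∀ a, (A.eta a : V ⊗[ℂ] V) = a ⊗ₜ A.vac + A.vac ⊗ₜ a := fun a => rfl
  rw [h, h, ← tensorProdₗ_apply]
  simp only [map_add, LinearMap.add_apply, tensorProdₗ_apply, tensorProd_tmul_vac,
    tensorProd_vac_tmul]
  abel

/-- The even and odd products differ only in the sign of the cross terms, so their sum is 2 η(a_(n)
b). The even product lies in C₂(T), and symmetrization contributes the other factor 2. -/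
theorem pullback_oddMode_oddVec (f : A.OrbifoldR →ₗ[ℂ] ℂ) {n : ℤ} (hn : n ≤ -2) (a b : V) :
    A.pullback f (A.oddMode n a (A.oddVec b)) = 4 * f (A.etaBar (A.prod n a b)) := by
  have h1 := A.pullback_tensorProd f hn (A.eta a).2 (A.eta b).2
  rw [tensorProd_eta_eta, map_add] at h1
  rw [oddMode_oddVec, map_sub]
  have h2 := A.pullback_eta f (A.prod n a b)
  linear_combination -h1 + 2 * h2

/-! ### Four-point functions of odd vectors -/

open Laurent in
/-- The correlation functions of four anti-invariant vectors. -/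
noncomputable def correlator (f : A.OrbifoldR →ₗ[ℂ] ℂ) (a : Fin 3 → V) (d : V)
    (N : Fin 3 → Fin 3 → ℕ) (M : Fin 3 → ℕ)
    (hN : ∀ i j, i ≠ j → ∀ n : ℤ, N i j ≤ n → A.prod n (a i) (a j) = 0)
    (hM : ∀ i, ∀ n : ℤ, M i ≤ n → A.prod n (a i) d = 0) : Correlator where
  φ i j k := liftMono fun n => A.pullback f
    (A.oddMode (n i) (a i) (A.oddMode (n j) (a j) (A.oddMode (n k) (a k) (A.oddVec d))))
  N := N
  M := M
  locality_outer i j k hij hik hjk g := by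
    induction g using Laurent.induction with
    | h0 => simp
    | ha g g' hg hg' => rw [mul_add, map_add, map_add, hg, hg']
    | hs c g hg => rw [mul_smul_comm, map_smul, map_smul, hg]
    | hm n =>
      rw [z_sub_z_pow_mul_mono, map_sum, map_sum, ← sub_eq_zero, ← Finset.sum_sub_distrib]
      have h := congrArg (A.pullback f) (A.oddMode_locality (hN i j hij) (n i) (n j)
        (A.oddMode (n k) (a k) (A.oddVec d)))
      rw [map_sum, map_zero] at h
      rw [← h]
      refine Finset.sum_congr rfl fun m _ => ?_
      simp [e_ne hij, e_ne hij.symm, e_ne hik.symm, e_ne hjk.symm, mul_sub, add_sub_assoc]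
  locality_inner i j k hij hik hjk g := by
    induction g using Laurent.induction with
    | h0 => simp
    | ha g g' hg hg' => rw [mul_add, map_add, map_add, hg, hg']
    | hs c g hg => rw [mul_smul_comm, map_smul, map_smul, hg]
    | hm n =>
      rw [z_sub_z_pow_mul_mono, map_sum, map_sum, ← sub_eq_zero, ← Finset.sum_sub_distrib]
      have h := congrArg (fun w => A.pullback f (A.oddMode (n i) (a i) w))
        (A.oddMode_locality (hN j k hjk) (n j) (n k) (A.oddVec d))
      simp only [map_sum, map_zero] at h
      rw [← h]
      refine Finset.sum_congr rfl fun m _ => ?_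
      simp [e_ne hij, e_ne hik, e_ne hjk, e_ne hjk.symm, mul_sub, add_sub_assoc]
  trunc_inner i j k _ _ _ n hn := by
    rw [liftMono_mono, A.oddMode_oddVec_eq_zero (by lia) (hM k _ hn)]
    simp
  trunc_outer i j k hij hik hjk n := by
    filter_upwards [A.eventually_oddMode_add_eq_zero (a j)
      (A.oddMode (n k) (a k) (A.oddVec d)) (n j)] with m hm
    simp [e_ne hij, e_ne hij.symm, e_ne hik.symm, e_ne hjk.symm, hm]
  expRel i j k hij hik hjk := by
    refine ⟨liftMono fun n => A.pullback f (A.tensorProd (n j)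
      (A.oddMode (n i) (a i) (A.oddVec (a j))) (A.oddMode (n k) (a k) (A.oddVec d))), ?_, ?_⟩
    · intro n
      filter_upwards [A.eventually_oddMode_iterate (a i) (a j) (n j) (n i)
        (A.oddMode (n k) (a k) (A.oddVec d))] with B hB
      rw [liftMono_mono, hB, map_sum]
      refine Finset.sum_congr rfl fun m _ => ?_
      simp [e_ne hij, e_ne hij.symm, e_ne hik.symm, e_ne hjk.symm, coef, sub_eq_add_neg,
        add_assoc]
      ring
    · intro n hn
      rw [liftMono_mono]
      exact A.pullback_tensorProd f hn (A.oddMode_oddVec_mem _ _ _) (A.oddMode_oddVec_mem _ _ _)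

theorem oddMode_oddVec_of_eq_smul_vac {a d : V} {k : ℤ} {l : ℂ} (hk : 0 ≤ k)
    (hl : A.prod k a d = l • A.vac) :
    A.oddMode k a (A.oddVec d) = (2 * l) • (A.vac ⊗ₜ A.vac) := by
  rw [oddMode_oddVec, hl, A.prod_vac_of_nonneg k a hk, ← TensorProduct.smul_tmul',
    TensorProduct.tmul_smul]
  simp only [TensorProduct.zero_tmul, TensorProduct.tmul_zero]
  module

theorem oddMode_neg_one_vac (a : V) : A.oddMode (-1) a (A.vac ⊗ₜ A.vac) = A.oddVec a := by
  rw [oddMode_tmul, prod_vac_neg_one, oddVec]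

theorem oddMode_vac_of_nonneg {n : ℤ} (hn : 0 ≤ n) (a : V) :
    A.oddMode n a (A.vac ⊗ₜ A.vac) = 0 := by
  simp [oddMode_tmul, A.prod_vac_of_nonneg n a hn]

/-- The innermost mode turns d into 2l 𝟏 ⊗ 𝟏, the mode -1 creates the odd vector of `a 1`, and the
last mode contributes 4 η̄: hence the factor 8l. -/
theorem correlator_apply (a : Fin 3 → V) (d : V) (N : Fin 3 → Fin 3 → ℕ) (M : Fin 3 → ℕ)
    (hN : ∀ i j, i ≠ j → ∀ n : ℤ, N i j ≤ n → A.prod n (a i) (a j) = 0)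
    (hM : ∀ i, ∀ n : ℤ, M i ≤ n → A.prod n (a i) d = 0) {k : ℤ} {l : ℂ} (hk : 0 ≤ k)
    (hkl : A.prod k (a 2) d = l • A.vac) (f : A.OrbifoldR →ₗ[ℂ] ℂ) {m : ℤ} (hm : 2 ≤ m) :
    (A.correlator f a d N M hN hM).φ 0 1 2 (Laurent.mono ![-m, -1, k]) =
      8 * l * f (A.etaBar (A.prod (-m) (a 0) (a 1))) := by
  have h : (A.correlator f a d N M hN hM).φ 0 1 2 (Laurent.mono ![-m, -1, k]) =
      A.pullback f (A.oddMode (-m) (a 0) (A.oddMode (-1) (a 1)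
        (A.oddMode k (a 2) (A.oddVec d)))) := by
    simp [correlator]
  rw [h, A.oddMode_oddVec_of_eq_smul_vac hk hkl, map_smul, oddMode_neg_one_vac, map_smul, map_smul,
    A.pullback_oddMode_oddVec f (by lia)]
  simp only [smul_eq_mul]
  ring

/-- The exponents (-m, -1, k) add up to less than -3 - total exactly under `hkm`. -/
theorem etaBar_prod_eq_zero_of_lt (a : Fin 3 → V) (d : V) (N : Fin 3 → Fin 3 → ℕ) (M : Fin 3 → ℕ)
    (hN : ∀ i j, i ≠ j → ∀ n : ℤ, N i j ≤ n → A.prod n (a i) (a j) = 0)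
    (hM : ∀ i, ∀ n : ℤ, M i ≤ n → A.prod n (a i) d = 0) {k : ℤ} {l : ℂ} (hk : 0 ≤ k) (hl : l ≠ 0)
    (hkl : A.prod k (a 2) d = l • A.vac) {m : ℤ} (hm : 2 ≤ m)
    (hkm : k + 2 + (N 0 1 + N 0 2 + N 1 2 + M 0 + M 1 + M 2 : ℕ) < m) :
    A.etaBar (A.prod (-m) (a 0) (a 1)) = 0 := by
  refine (Module.forall_dual_apply_eq_zero_iff ℂ _).1 fun f => ?_
  have h := (A.correlator f a d N M hN hM).φ_mono_eq_zero (n := ![-m, -1, k]) (by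
    simp [Laurent.Correlator.total, correlator]; push_cast at hkm; lia)
  rw [A.correlator_apply a d N M hN hM hk hkl f hm] at h
  simpa [hl] using h

/-- When k = M_2 - 1 is the top mode, it produces the vacuum, which all modes n ≥ 0 annihilate; this
is the extra input for the boundary degree. -/
theorem etaBar_prod_eq_zero_of_le (a : Fin 3 → V) (d : V) (N : Fin 3 → Fin 3 → ℕ) (M : Fin 3 → ℕ)
    (hN : ∀ i j, i ≠ j → ∀ n : ℤ, N i j ≤ n → A.prod n (a i) (a j) = 0)
    (hM : ∀ i, ∀ n : ℤ, M i ≤ n → A.prod n (a i) d = 0) {k : ℤ} {l : ℂ} (hk : 0 ≤ k) (hl : l ≠ 0)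
    (hkl : A.prod k (a 2) d = l • A.vac) (hN12 : 0 < N 1 2) (hkM : k = M 2 - 1) {m : ℤ}
    (hm : 2 ≤ m) (hkm : k + 2 + (N 0 1 + N 0 2 + N 1 2 + M 0 + M 1 + M 2 : ℕ) ≤ m) :
    A.etaBar (A.prod (-m) (a 0) (a 1)) = 0 := by
  refine (Module.forall_dual_apply_eq_zero_iff ℂ _).1 fun f => ?_
  have h := (A.correlator f a d N M hN hM).φ_mono_eq_zero_of_top hN12 (by
    intro n h2 h1
    have h2' : n 2 = k := by rw [hkM]; exact h2
    simp [correlator, h2', A.oddMode_oddVec_of_eq_smul_vac hk hkl, A.oddMode_vac_of_nonneg h1])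
    (n := ![-m, -1, k]) (by
    simp [Laurent.Correlator.total, correlator]; push_cast at hkm; lia)
  rw [A.correlator_apply a d N M hN hM hk hkl f hm] at h
  simpa [hl] using h

/-! ### Skew-symmetry modulo C₂(T) -/

/-- The Borcherds identity for b, a, 𝟏 with (p, q, r) = (-1, 0, n): nonnegative modes kill 𝟏,
leaving one term on the right. -/
theorem skew_symmetry (a b : V) (n : ℤ) : A.prod n a b =
    ∑ᶠ i : ℕ, ((-1 : ℤ) ^ i * -(n.negOnePow : ℤ)) •
      A.prod (-1 - i) (A.prod (n + i) b a) A.vac := by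
  have h := A.borcherds b a A.vac (-1) 0 n
  have hr : (∑ᶠ i : ℕ, ((-1 : ℤ) ^ i * Ring.choose n i) •
        (A.prod (-1 + n - i) b (A.prod (0 + i) a A.vac) -
          (n.negOnePow : ℤ) • A.prod (0 + n - i) a (A.prod (-1 + i) b A.vac))) =
      -(n.negOnePow : ℤ) • A.prod n a b := by
    rw [finsum_eq_single _ 0]
    · simp [A.prod_vac_of_nonneg 0 a le_rfl, A.prod_vac_neg_one]
    · intro i hi
      rw [A.prod_vac_of_nonneg _ a (by lia), A.prod_vac_of_nonneg _ b (by lia)]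
      simp
  have hs : (n.negOnePow : ℤ) * (n.negOnePow : ℤ) = 1 := by
    rw [← Units.val_mul, Int.units_mul_self]; rfl
  rw [hr] at h
  have h2 : A.prod n a b = -(n.negOnePow : ℤ) • -(n.negOnePow : ℤ) • A.prod n a b := by
    rw [smul_smul, neg_mul_neg, hs, one_smul]
  have hf : (Function.support fun i : ℕ => Ring.choose (-1 : ℤ) i •
      A.prod (-1 + 0 - i) (A.prod (n + i) b a) A.vac).Finite := by
    obtain ⟨B, hB⟩ := eventually_atTop.1 (A.eventually_prod_add_eq_zero b a n)
    refine (Finset.range B).finite_toSet.subset fun i hi => ?_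
    simp only [Finset.coe_range, Set.mem_Iio]
    by_contra! hc
    apply hi
    simp [hB i hc]
  rw [h2, ← h, smul_finsum' _ hf]
  refine finsum_congr fun i => ?_
  have hc : Ring.choose (-1 : ℤ) i = (-1) ^ i := by
    rw [Ring.choose_neg]
    simp [Int.negOnePow_def, Ring.choose_natCast, Units.smul_def]
  rw [hc, smul_smul, add_zero, mul_comm]

theorem prod_eq_zero_of_swap {a b : V} {N : ℤ} (h : ∀ n, N ≤ n → A.prod n b a = 0) (n : ℤ)
    (hn : N ≤ n) : A.prod n a b = 0 := by
  rw [skew_symmetry, ← finsum_zero (α := ℕ)]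
  refine finsum_congr fun i => ?_
  rw [h _ (by lia)]
  simp

theorem etaBar_prod_vac {n : ℤ} (hn : n ≤ -2) (a : V) : A.etaBar (A.prod n a A.vac) = 0 := by
  have h : A.eta (A.prod n a A.vac) = (1 / 2 : ℂ) • A.orbifoldProd n (A.eta a) (A.eta A.vac) := by
    refine Subtype.ext ?_
    change A.prod n a A.vac ⊗ₜ[ℂ] A.vac + A.vac ⊗ₜ[ℂ] A.prod n a A.vac =
      (1 / 2 : ℂ) • A.tensorProd n (A.eta a) (A.eta A.vac)
    rw [tensorProd_eta_eta]
    module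
  rw [etaBar, LinearMap.comp_apply, h, map_smul]
  have h2 : A.orbifoldC2.mkQ (A.orbifoldProd n (A.eta a) (A.eta A.vac)) = 0 := by
    simpa using A.orbifoldProd_mem_orbifoldC2 hn (A.eta a) (A.eta A.vac)
  rw [h2, smul_zero]

/-- The corrections in skew-symmetry have the form c_(-1-i) 𝟏 with i ≥ 1, and η̄ kills these. -/
theorem etaBar_prod_swap (a b : V) (n : ℤ) :
    A.etaBar (A.prod n a b) = -(n.negOnePow : ℤ) • A.etaBar (A.prod n b a) := by
  have hf : (Function.support fun i : ℕ => ((-1 : ℤ) ^ i * -(n.negOnePow : ℤ)) •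
      A.prod (-1 - i) (A.prod (n + i) b a) A.vac).Finite := by
    obtain ⟨B, hB⟩ := eventually_atTop.1 (A.eventually_prod_add_eq_zero b a n)
    refine (Finset.range B).finite_toSet.subset fun i hi => ?_
    simp only [Finset.coe_range, Set.mem_Iio]
    by_contra! hc
    apply hi
    simp [hB i hc]
  rw [skew_symmetry]
  refine (A.etaBar.toAddMonoidHom.map_finsum hf).trans ?_
  rw [finsum_eq_single _ 0]
  · simp [A.prod_vac_neg_one]
  · intro i hi
    change A.etaBar _ = 0
    rw [map_zsmul, A.etaBar_prod_vac (by lia), smul_zero]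

/-! ### The ideal generated by a vector -/

/-- The span of all `a_(n) x`. -/
def orbitSpan (x : V) : Submodule ℂ V := Submodule.span ℂ {w | ∃ (a : V) (n : ℤ), w = A.prod n a x}

theorem prod_mem_orbitSpan (n : ℤ) (a x : V) : A.prod n a x ∈ A.orbitSpan x :=
  Submodule.subset_span ⟨a, n, rfl⟩

theorem finsum_mem_submodule {ι : Type*} {p : Submodule ℂ V} {f : ι → V} (h : ∀ i, f i ∈ p) :
    ∑ᶠ i, f i ∈ p :=
  finsum_induction (· ∈ p) p.zero_mem (fun _ _ => p.add_mem) h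

theorem prod_prod_mem_orbitSpan (a b x : V) (m n : ℤ) :
    A.prod m b (A.prod n a x) ∈ A.orbitSpan x := by
  obtain ⟨N, hN⟩ := A.truncation a x
  obtain ⟨M, hM⟩ := A.truncation b x
  obtain ⟨k, hk⟩ : ∃ k : ℕ, N - n ≤ k := ⟨(N - n).toNat, by lia⟩
  induction k using Nat.strong_induction_on generalizing m n with
  | _ k ih =>
    -- With p = M beyond the truncation of b on x, half of the right side disappears. The term i = 0
    -- is b_(m) (a_(n) x); the others raise the index of a towards its truncation, which drives the
    -- induction.
    have h := A.borcherds b a x M n (m - M)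
    have hl : (∑ᶠ i : ℕ, Ring.choose M i • A.prod (M + n - i) (A.prod (m - M + i) b a) x) ∈
        A.orbitSpan x :=
      finsum_mem_submodule fun i => zsmul_mem (A.prod_mem_orbitSpan _ _ _) _
    rw [h] at hl
    have hz : ∀ i : ℕ, A.prod (M + i) b x = 0 := fun i => hM _ (by lia)
    simp only [hz, map_zero, smul_zero, sub_zero] at hl
    obtain ⟨B, hB, hB1⟩ := ((eventually_finsum_eq_sum_range (f := fun i : ℕ =>
      ((-1 : ℤ) ^ i * Ring.choose (m - M) i) • A.prod (M + (m - M) - i) b (A.prod (n + i) a x))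
      (by
        filter_upwards [A.eventually_prod_add_eq_zero a x n] with j hj
        simp [hj])).and (eventually_ge_atTop 1)).exists
    obtain ⟨B, rfl⟩ := Nat.exists_eq_add_of_le' hB1
    rw [hB, Finset.sum_range_succ'] at hl
    have hs : ∑ i ∈ Finset.range B, ((-1 : ℤ) ^ (i + 1) * Ring.choose (m - M) (i + 1)) •
        A.prod (M + (m - M) - ((i + 1 : ℕ) : ℤ)) b (A.prod (n + ((i + 1 : ℕ) : ℤ)) a x) ∈
        A.orbitSpan x := by
      refine Submodule.sum_mem _ fun i _ => zsmul_mem ?_ _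
      by_cases hNn : N ≤ n + ((i + 1 : ℕ) : ℤ)
      · rw [hN _ hNn]; simp
      · exact ih (k - (i + 1)) (by lia) _ _ (by lia)
    have := (Submodule.add_mem_iff_right _ hs).1 hl
    simpa using this

theorem prod_mem_orbitSpan_of_mem {x w : V} (hw : w ∈ A.orbitSpan x) (m : ℤ) (b : V) :
    A.prod m b w ∈ A.orbitSpan x := by
  induction hw using Submodule.span_induction with
  | mem w hw => obtain ⟨a, n, rfl⟩ := hw; exact A.prod_prod_mem_orbitSpan a b x m n
  | zero => simp
  | add u v _ _ hu hv => rw [map_add]; exact Submodule.add_mem _ hu hv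
  | smul c u _ hu => rw [map_smul]; exact Submodule.smul_mem _ c hu

/-- A subspace stable under left products and under translation is an ideal. -/
theorem isIdeal_of_left {I : Submodule ℂ V} (hl : ∀ (n : ℤ) (a : V), ∀ w ∈ I, A.prod n a w ∈ I)
    (ht : ∀ w ∈ I, A.prod (-2) w A.vac ∈ I) : A.IsIdeal I := by
  have hvac : ∀ i : ℕ, ∀ w ∈ I, A.prod (-1 - i) w A.vac ∈ I := by
    intro i
    induction i with
    | zero => intro w hw; simpa [A.prod_vac_neg_one] using hw
    | succ i ih =>
      intro w hw
      have h := ih _ (ht w hw)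
      have hi : (-1 : ℤ) - i - 1 = -1 - ((i + 1 : ℕ) : ℤ) := by push_cast; ring
      rw [prod_translation, ← Int.cast_smul_eq_zsmul ℂ, Submodule.smul_mem_iff, hi] at h
      · exact h
      · exact_mod_cast (by lia : -(-1 - (i : ℤ)) ≠ 0)
  intro a w hw n
  refine ⟨hl n a w hw, ?_⟩
  rw [skew_symmetry]
  exact finsum_mem_submodule fun i => zsmul_mem (hvac i _ (hl _ _ _ hw)) _

end VertexAlgebra

/-! ### Weights, simplicity and explicit bounds -/

namespace VertexOperatorAlgebra

variable {V : Type*} [AddCommGroup V] [Module ℂ V] (A : VertexOperatorAlgebra V)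

theorem mem_weightSpace {d : ℤ} {a : V} : a ∈ A.weightSpace d ↔ A.prod 1 A.omega a = (d : ℂ) • a :=
  Module.End.mem_eigenspace_iff

theorem prod_mem_weightSpace {d e : ℤ} {a b : V} (ha : a ∈ A.weightSpace d)
    (hb : b ∈ A.weightSpace e) (n : ℤ) : A.prod n a b ∈ A.weightSpace (d + e - n - 1) := by
  rw [mem_weightSpace] at ha hb ⊢
  have h := A.borcherds A.omega a b 1 n 0
  have hl : (∑ᶠ i : ℕ, Ring.choose (1 : ℤ) i •
      A.prod (1 + n - i) (A.prod (0 + i) A.omega a) b) =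
      A.prod (1 + n) (A.prod 0 A.omega a) b + A.prod n (A.prod 1 A.omega a) b := by
    rw [finsum_eq_sum_of_support_subset (s := Finset.range 2)]
    · simp [Finset.sum_range_succ]
    · intro i hi
      simp only [Finset.coe_range, Set.mem_Iio]
      by_contra! hc
      apply hi
      have : Ring.choose (1 : ℤ) i = 0 := by
        have := Ring.choose_natCast (R := ℤ) 1 i
        rw [Nat.choose_eq_zero_of_lt (by lia)] at this
        simpa using this
      simp only [this, zero_smul]
  have hr : (∑ᶠ i : ℕ, ((-1 : ℤ) ^ i * Ring.choose (0 : ℤ) i) •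
      (A.prod (1 + 0 - i) A.omega (A.prod (n + i) a b) -
        ((0 : ℤ).negOnePow : ℤ) • A.prod (n + 0 - i) a (A.prod (1 + i) A.omega b))) =
      A.prod 1 A.omega (A.prod n a b) - A.prod n a (A.prod 1 A.omega b) := by
    rw [finsum_eq_single _ 0]
    · simp
    · intro i hi
      rw [Ring.choose_zero_pos ℤ (Nat.pos_of_ne_zero hi), mul_zero, zero_smul]
  rw [hl, hr, A.translation, A.prod_translation, ha, hb, map_smul, map_smul, LinearMap.smul_apply,
    ← Int.cast_smul_eq_zsmul ℂ, add_sub_cancel_left] at h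
  rw [eq_sub_iff_add_eq] at h
  rw [← h]
  push_cast
  module

theorem vac_mem_weightSpace : A.vac ∈ A.weightSpace 0 := by
  rw [mem_weightSpace, A.prod_vac_of_nonneg 1 _ (by decide)]
  simp

theorem iSup_weightSpace : ⨆ d : ℤ, A.weightSpace d = ⊤ :=
  A.isInternal.submodule_iSup_eq_top

theorem prod_eq_zero_of_weight (hCFT : A.IsCFTType) {d e : ℤ} {a b : V} (ha : a ∈ A.weightSpace d)
    (hb : b ∈ A.weightSpace e) {n : ℤ} (hn : d + e ≤ n) : A.prod n a b = 0 := by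
  have h := A.prod_mem_weightSpace ha hb n
  rw [hCFT.1 _ (by lia)] at h
  simpa using h

theorem exists_prod_eq_smul_vac (hCFT : A.IsCFTType) {d e n : ℤ} {a b : V}
    (ha : a ∈ A.weightSpace d) (hb : b ∈ A.weightSpace e) (hn : n = d + e - 1) :
    ∃ c : ℂ, A.prod n a b = c • A.vac := by
  have h := A.prod_mem_weightSpace ha hb n
  rw [show d + e - n - 1 = 0 by lia, hCFT.2, Submodule.mem_span_singleton] at h
  obtain ⟨c, hc⟩ := h
  exact ⟨c, hc.symm⟩

theorem isIdeal_orbitSpan (x : V) : A.IsIdeal (A.orbitSpan x) := by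
  refine A.isIdeal_of_left (fun n a w hw => A.prod_mem_orbitSpan_of_mem hw n a) fun w hw => ?_
  rw [← A.translation]
  exact A.prod_mem_orbitSpan_of_mem hw 0 _

theorem vac_ne_zero (hsimple : A.IsSimple) : A.vac ≠ 0 := by
  intro h
  obtain ⟨⟨a, b, hab⟩, -⟩ := hsimple
  have key : ∀ a : V, a = 0 := by
    intro a
    have := A.vac_prod (-1) a
    rw [h] at this
    simpa using this.symm
  exact hab ((key a).trans (key b).symm)

/-- Otherwise no a_(n) x has a component in V_0, so the nonzero ideal spanned by these vectors
misses 𝟏, against simplicity. -/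
theorem exists_dual_vector (hsimple : A.IsSimple) (hCFT : A.IsCFTType) {x : V}
    (hx : x ∈ A.weightSpace 1) (hx0 : x ≠ 0) :
    ∃ (k : ℤ) (a : V) (l : ℂ), 0 ≤ k ∧ l ≠ 0 ∧ A.prod k a x = l • A.vac := by
  by_contra! hcon
  have hzero : ∀ (d : ℤ) (a : V), a ∈ A.weightSpace d → A.prod d a x = 0 := by
    intro d a ha
    obtain ⟨l, hl⟩ := A.exists_prod_eq_smul_vac hCFT ha hx (show d = d + 1 - 1 by ring)
    rcases lt_or_ge d 0 with hd | hd
    · rw [hCFT.1 d hd, Submodule.mem_bot] at ha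
      simp [ha]
    · by_cases hl0 : l = 0
      · rw [hl, hl0, zero_smul]
      · exact absurd hl (hcon d a l hd hl0)
  have hle : A.orbitSpan x ≤ ⨆ d : ℤ, ⨆ (_ : d ≠ 0), A.weightSpace d := by
    refine Submodule.span_le.2 ?_
    rintro _ ⟨a, n, rfl⟩
    have ha : a ∈ ⨆ d : ℤ, A.weightSpace d := by rw [iSup_weightSpace]; trivial
    induction ha using Submodule.iSup_induction' with
    | mem d a ha =>
      by_cases hdn : d = n
      · subst hdn
        rw [hzero d a ha]
        exact Submodule.zero_mem _
      · have h := A.prod_mem_weightSpace ha hx n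
        refine Submodule.mem_iSup_of_mem (d + 1 - n - 1) (Submodule.mem_iSup_of_mem (by lia) h)
    | zero => simp
    | add a b _ _ ha hb =>
      rw [map_add, LinearMap.add_apply]
      exact Submodule.add_mem _ ha hb
  have hxmem : x ∈ A.orbitSpan x := by
    have h := A.prod_mem_orbitSpan (-1) A.vac x
    rwa [A.vac_prod, if_pos rfl] at h
  have htop : A.orbitSpan x = ⊤ := by
    refine (hsimple.2 _ (A.isIdeal_orbitSpan x)).resolve_left fun hbot => hx0 ?_
    rw [hbot] at hxmem
    simpa using hxmem
  have hind : iSupIndep A.weightSpace := A.isInternal.submodule_iSupIndep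
  have hdis := hind 0
  rw [Submodule.disjoint_def] at hdis
  exact A.vac_ne_zero hsimple (hdis _ A.vac_mem_weightSpace (hle (by rw [htop]; trivial)))

theorem exists_poleOrder (a b : V) : ∃ N : ℕ, ∀ n : ℤ, N ≤ n → A.prod n a b = 0 := by
  obtain ⟨N, hN⟩ := A.truncation a b
  exact ⟨N.toNat, fun n hn => hN n (by lia)⟩

theorem exists_forall_etaBar_eq_zero (hsimple : A.IsSimple) (hCFT : A.IsCFTType) {x : V}
    (hx : x ∈ A.weightSpace 1) (y : V) :
    ∃ B : ℤ, ∀ m : ℤ, B ≤ m → A.etaBar (A.prod (-m) x y) = 0 := by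
  by_cases hx0 : x = 0
  · exact ⟨0, fun m _ => by simp [hx0]⟩
  obtain ⟨k, a, l, hk, hl, hkl⟩ := A.exists_dual_vector hsimple hCFT hx hx0
  choose N hN using fun i j : Fin 3 => A.exists_poleOrder (![x, y, a] i) (![x, y, a] j)
  choose M hM using fun i : Fin 3 => A.exists_poleOrder (![x, y, a] i) x
  exact ⟨k + 3 + (N 0 1 + N 0 2 + N 1 2 + M 0 + M 1 + M 2 : ℕ), fun m hm =>
    A.etaBar_prod_eq_zero_of_lt ![x, y, a] x N M (fun i j _ => hN i j) hM hk hl hkl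
      (by push_cast at hm; lia) (by push_cast at hm ⊢; lia)⟩

theorem finiteDimensional_D (hsimple : A.IsSimple) (hCFT : A.IsCFTType) {x : V}
    (hx : x ∈ A.weightSpace 1) (y : V) : FiniteDimensional ℂ (A.D x y) := by
  obtain ⟨B, hB⟩ := A.exists_forall_etaBar_eq_zero hsimple hCFT hx y
  have hfin : ((fun n : ℤ => A.etaBar (A.prod (-n) x y)) '' Set.Icc 0 B ∪ {0}).Finite :=
    ((Set.finite_Icc _ _).image _).union (Set.finite_singleton _)
  have := FiniteDimensional.span_of_finite ℂ hfin
  refine Submodule.finiteDimensional_of_le (S₂ := Submodule.span ℂ _)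
    (Submodule.span_mono (t := (fun n : ℤ => A.etaBar (A.prod (-n) x y)) '' Set.Icc 0 B ∪ {0}) ?_)
  rintro _ ⟨n, hn, rfl⟩
  by_cases h : n ≤ B
  · exact Or.inl ⟨n, ⟨hn.le, h⟩, rfl⟩
  · exact Or.inr (hB n (by lia))

theorem etaBar_prod_self (hCFT : A.IsCFTType) {x : V} (hx : x ∈ A.weightSpace 1) {c : ℂ}
    (hc : A.prod 1 x x = c • A.vac) (hc0 : c ≠ 0) {m : ℤ} (hm : 14 ≤ m) :
    A.etaBar (A.prod (-m) x x) = 0 := by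
  rcases Int.even_or_odd m with he | ho
  · have h := A.etaBar_prod_swap x x (-m)
    rw [Int.negOnePow_neg, Int.negOnePow_even m he, Units.val_one, neg_one_smul,
      eq_neg_iff_add_eq_zero, ← two_smul ℂ] at h
    exact (smul_eq_zero.1 h).resolve_left two_ne_zero
  · have hpole : ∀ n : ℤ, ((2 : ℕ) : ℤ) ≤ n → A.prod n x x = 0 :=
      fun n hn => A.prod_eq_zero_of_weight hCFT hx hx hn
    have hm' : 15 ≤ m := by
      obtain ⟨t, rfl⟩ := ho
      lia
    -- Six pole orders equal to 2 and k = 1 give the bound 1 + 2 + 12 = 15, the first odd value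
    -- left.
    exact A.etaBar_prod_eq_zero_of_le (fun _ => x) x (fun _ _ => 2) (fun _ => 2)
      (fun _ _ _ => hpole) (fun _ => hpole) (k := 1) (by decide) hc0 hc (by decide) (by decide)
      (by lia) (by push_cast; lia)

theorem etaBar_prod_of_prod_one_eq_zero (hCFT : A.IsCFTType) {x y : V} (hx : x ∈ A.weightSpace 1)
    (hy : y ∈ A.weightSpace 1) {c : ℂ} (hc : A.prod 1 x x = c • A.vac) (hc0 : c ≠ 0)
    (hxy : A.prod 1 x y = 0) {m : ℤ} (hm : 13 ≤ m) : A.etaBar (A.prod (-m) x y) = 0 := by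
  have hxx : ∀ n : ℤ, ((2 : ℕ) : ℤ) ≤ n → A.prod n x x = 0 :=
    fun n hn => A.prod_eq_zero_of_weight hCFT hx hx hn
  have hxy' : ∀ n : ℤ, ((1 : ℕ) : ℤ) ≤ n → A.prod n x y = 0 := by
    intro n hn
    rcases eq_or_lt_of_le hn with h | h
    · rw [← h]; simpa using hxy
    · exact A.prod_eq_zero_of_weight hCFT hx hy (by push_cast at h; lia)
  have hyx : ∀ n : ℤ, ((1 : ℕ) : ℤ) ≤ n → A.prod n y x = 0 := A.prod_eq_zero_of_swap hxy'
  -- Orthogonality lowers the x–y pole orders to 1, so the total is 9 and the condition reads 1 + 2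
  -- + 9 < m.
  refine A.etaBar_prod_eq_zero_of_lt ![x, y, x] x !![0, 1, 2; 1, 0, 1; 2, 1, 0] ![2, 1, 2]
    ?_ ?_ (k := 1) (by decide) hc0 hc (by lia) ?_
  · intro i j hij
    fin_cases i <;> fin_cases j <;> first | exact absurd rfl hij | assumption
  · intro i
    fin_cases i <;> assumption
  · change (1 : ℤ) + 2 + ((1 + 2 + 1 + 2 + 1 + 2 : ℕ) : ℤ) < m
    push_cast
    lia

end VertexOperatorAlgebra

theorem mainTheorem5 {V : Type*} [AddCommGroup V] [Module ℂ V] (A : VertexOperatorAlgebra V)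
    (hsimple : A.IsSimple) (hCFT : A.IsCFTType) (x y : V)
    (hx : x ∈ A.weightSpace 1) (hy : y ∈ A.weightSpace 1) :
    FiniteDimensional ℂ (A.D x y) ∧
      ∀ c : ℂ, A.prod 1 x x = c • A.vac → c ≠ 0 →
        ∀ m : ℤ, 14 ≤ m → A.etaBar (A.prod (-m) x y) = 0 := by
  refine ⟨A.finiteDimensional_D hsimple hCFT hx y, fun c hc hc0 m hm => ?_⟩
  obtain ⟨l, hl⟩ := A.exists_prod_eq_smul_vac hCFT hx hy (show (1 : ℤ) = 1 + 1 - 1 by norm_num)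
  -- The component of y orthogonal to x; both pieces vanish for m ≥ 14.
  have hy' : y - (l / c) • x ∈ A.weightSpace 1 :=
    Submodule.sub_mem _ hy (Submodule.smul_mem _ _ hx)
  have h0 : A.prod 1 x (y - (l / c) • x) = 0 := by
    rw [map_sub, map_smul, hl, hc, smul_smul, div_mul_cancel₀ _ hc0, sub_self]
  have h1 := A.etaBar_prod_of_prod_one_eq_zero hCFT hx hy' hc hc0 h0 (show 13 ≤ m by lia)
  rw [map_sub, map_sub, map_smul, map_smul, A.etaBar_prod_self hCFT hx hc hc0 hm, smul_zero,
    sub_zero] at h1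
  exact h1
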